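/- Let $S$ be a finite set of points in the Euclidean plane in general position, i.e., no three points of $S$ are collinear. Let $L_0\subseteq S$ be the set of points of $S$ that lie on the boundary of the convex hull of $S$; for $i\ge 1$ let $L_i$ be the set of points of $S_i:=S\setminus\bigcup_{k<i}L_k$ that lie on the boundary of the convex hull of $S_i$. Suppose that at most two of the layers $L_0,L_1,\dots$ are non-empty, and let $s\in L_0$. A plane spanning path on $S$ is a path that visits every point of $S$ exactly once, whose edges are straight-line segments between points of $S$, no two of which intersect except at a common endpoint; a path is identified with its set of edges. Let $\mathcal P(S,s)$ be the set of all plane spanning paths on $S$ that have $s$ as an endpoint (if $S=\{s\}$, this is the single path without edges). The flip graph of $\mathcal P(S,s)$ has vertex set $\mathcal P(S,s)$, and two paths $P,P'\in\mathcal P(S,s)$ are adjacent if and only if $P'$ is obtained from $P$ by a flip, i.e., by replacing one edge of $P$ with another edge between two points of $S$. Then the flip graph of $\mathcal P(S,s)$ is connected. -/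

import Mathlib

namespace PlanePath

/-- The Euclidean plane. -/
abbrev Plane : Type := EuclideanSpace ℝ (Fin 2)

/-- No three (distinct) points of `S` are collinear. -/
def GeneralPosition (S : Finset Plane) : Prop :=
  ∀ a ∈ S, ∀ b ∈ S, ∀ c ∈ S, a ≠ b → a ≠ c → b ≠ c →
    ¬ Collinear ℝ ({a, b, c} : Set Plane)

/-- The outer points of `A`: those on the boundary of the convex hull of `A`. -/
def outerPoints (A : Set Plane) : Set Plane :=
  {p | p ∈ A ∧ p ∈ frontier (convexHull ℝ A)}

/-- What is left of `A` after removing its first `i` layers. -/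
def peel (A : Set Plane) : ℕ → Set Plane
  | 0 => A
  | i + 1 => peel A i \ outerPoints (peel A i)

/-- The layer `L_i` of `A`: the outer points of what is left after removing `L_0, …, L_{i-1}`. -/
def layer (A : Set Plane) (i : ℕ) : Set Plane :=
  outerPoints (peel A i)

/-- The layer number: how many layers are non-empty. -/
noncomputable def layerNumber (A : Set Plane) : ℕ∞ :=
  {i : ℕ | (layer A i).Nonempty}.encard

/-- The graph `P`, taken as a set of edges on the vertex set `V`, is a path from `u` to `v` that
visits every vertex exactly once: some walk of `P` from `u` to `v` repeats no vertex, visits every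
vertex, and uses every edge of `P`. -/
def IsSpanningPathBetween {V : Type*} (P : SimpleGraph V) (u v : V) : Prop :=
  ∃ w : P.Walk u v, w.IsPath ∧ (∀ x : V, x ∈ w.support) ∧ ∀ e ∈ P.edgeSet, e ∈ w.edges

/-- Drawn with straight-line segments, two different edges of `P` meet at most in a common
endpoint. -/
def IsPlane {S : Finset Plane} (P : SimpleGraph S) : Prop :=
  ∀ a b c d : S, P.Adj a b → P.Adj c d → s(a, b) ≠ s(c, d) →
    segment ℝ (a : Plane) (b : Plane) ∩ segment ℝ (c : Plane) (d : Plane) ⊆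
      ({(a : Plane), (b : Plane)} ∩ {(c : Plane), (d : Plane)} : Set Plane)

/-- The set `𝒫(S)` of all plane spanning paths on `S`. -/
def planeSpanningPaths (S : Finset Plane) : Set (SimpleGraph S) :=
  {P | (∃ u v : S, IsSpanningPathBetween P u v) ∧ IsPlane P}

/-- The set `𝒫(S, s)` of all plane spanning paths on `S` with `s` as an endpoint. -/
def planeSpanningPathsFrom (S : Finset Plane) (s : S) : Set (SimpleGraph S) :=
  {P | P ∈ planeSpanningPaths S ∧ ∃ t : S, IsSpanningPathBetween P s t}

/-- `Q` arises from `P` by replacing an edge `e` of `P` with another edge `f`. -/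
def IsFlip {V : Type*} (P Q : SimpleGraph V) : Prop :=
  ∃ e ∈ P.edgeSet, ∃ f ∉ P.edgeSet, Q.edgeSet = insert f (P.edgeSet \ {e})

theorem IsFlip.symm {V : Type*} {P Q : SimpleGraph V} (h : IsFlip P Q) : IsFlip Q P := by
  obtain ⟨e, he, f, hf, hQ⟩ := h
  have hef : e ≠ f := fun h => hf (h ▸ he)
  refine ⟨f, by simp [hQ], e, by simp [hQ, hef], ?_⟩
  rw [hQ]
  ext x
  by_cases hx : x = e
  · subst hx
    simp [he]
  · by_cases hx' : x = f
    · subst hx'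
      simp [hf, hx]
    · simp [hx, hx']

theorem IsFlip.irrefl {V : Type*} (P : SimpleGraph V) : ¬ IsFlip P P := by
  rintro ⟨e, _, f, hf, hP⟩
  exact hf (by rw [hP]; exact Set.mem_insert _ _)

/-- The flip graph of a set `Ps` of plane spanning paths: its vertices are the paths in `Ps`, and
two of them are adjacent when a flip transforms one into the other. -/
def flipGraph {S : Finset Plane} (Ps : Set (SimpleGraph S)) : SimpleGraph Ps where
  Adj P Q := IsFlip (P : SimpleGraph S) (Q : SimpleGraph S)
  symm := ⟨fun _ _ h => h.symm⟩
  loopless := ⟨fun P h => IsFlip.irrefl (P : SimpleGraph S) h⟩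

end PlanePath

/-! A path from `s` is written as the list of its points, and every flip used reverses a final
stretch of that list: `… v x … t` becomes `… v t … x`, which exchanges the edge `vx` for `vt` and
keeps the start `s`.

The proof is by induction on the number of points (`connected_of_twoLayers`). Two paths with the
same first edge `sv`, a hull edge, are handled by deleting `s`: then `v` is a hull point of the
remaining set, which still has at most two layers. The list of the other points in angular order
around `s` begins at one hull neighbour of `s` and ends at the other, and it and its reversal both
give plane paths, one flip apart. So it suffices to flip every path to one whose first edge is a
hull edge (`exists_good`).

To that end the number of hull edges is raised. If the last point `t` is a hull point, it has a hull
neighbour `b` other than its predecessor, and flipping at `b` gains the hull edge `bt`. The edge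
`bd` lost is not a hull edge: otherwise `d` and `t` would be the two hull neighbours of `b`, and the
part of the path from `s` to `b` would have to cross the part from `d` to `t` (`not_hullEdge_next`,
a parity argument). If the path ends in a run of inner points, the run can be reordered by flips so
that its last point sees both ends of a non-hull edge of the initial part (`exists_last_sees`); two
flips move that point into this edge (`reach_insert`), which shortens the run and keeps the number
of hull edges.

The two-layer hypothesis says that no triangle of inner points contains another point in its
interior. Hence edges of the initial part do not separate points of the run (`TwoLayers.not_cr`),
and by induction the run can be reordered freely behind its first point. The required sight lines
come from sweeping triangles and turning a sight line towards the first point met (`sweep`,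
`Visibility.win_of_left`, `Visibility.next_of_left`).

Only orientations of triples enter, through two axioms that hold for determinants; statements about
at most five points are checked over all sign patterns. -/

/-- An abstract orientation predicate on triples, satisfied by points of the plane in general
position: `o a b c` says that `a, b, c` is a left turn. -/
structure CCSystem (V : Type*) where
  o : V → V → V → Bool
  rot : ∀ a b c, o b c a = o a b c
  deg : ∀ a b, o a a b = false
  swap : ∀ a b c, a ≠ b → b ≠ c → a ≠ c → o b a c = !o a b c
  acyclic : ∀ a b c x, [a, b, c, x].Nodup →
    (!(o a b x == o b c x && o b c x == o c a x && o a b c != o a b x)) = true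
  gp : ∀ r a b c d, [r, a, b, c, d].Nodup →
    (!((o r a b == o r c d) == (o r a c != o r b d) &&
      (o r a b == o r c d) == (o r a d == o r b c))) = true

/-! ### Orientation facts on at most five points. -/

namespace CCSystem

/-- `p` lies in the interior of the triangle `a b c`. -/
def tri {V : Type*} (o : V → V → V → Bool) (p a b c : V) : Bool :=
  (o a b p && o b c p && o c a p) || (o b a p && o c b p && o a c p)

/-- The segments `a b` and `x y` cross in their relative interiors. -/
def cross {V : Type*} (o : V → V → V → Bool) (a b x y : V) : Bool :=
  ((o a b x && o b a y) || (o a b y && o b a x)) && ((o x y a && o y x b) || (o x y b && o y x a))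

/-- The orientation predicate on `Fin 5` with prescribed values on increasing triples. -/
def table (a b c d e f g h i j : Bool) (x y z : Fin 5) : Bool :=
  let s (u v w : ℕ) : Bool :=
    match u, v, w with
    | 0, 1, 2 => a | 0, 1, 3 => b | 0, 1, 4 => c | 0, 2, 3 => d | 0, 2, 4 => e
    | 0, 3, 4 => f | 1, 2, 3 => g | 1, 2, 4 => h | 1, 3, 4 => i | 2, 3, 4 => j
    | _, _, _ => false
  if y = z then false
  else if x < y then if y < z then s x y z else if x < z then !s x z y else if z < x then s z x y
    else false
  else if y < x then if x < z then !s y x z else if y < z then s y z x else if z < y then !s z y x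
    else false
  else false

/-- The axioms of a `CCSystem` on `Fin 5`, in terms of the values on increasing triples. -/
def valid (a b c d e f g h i j : Bool) : Bool :=
  let ac (u v w z : Bool) : Bool := !(v == w && w == !z && u != v)
  let gp (u v w x y z : Bool) : Bool := !((u == v) == (w != x) && (u == v) == (y == z))
  ac a b g d && (ac a c h e && (ac b c i f && (ac d e j f && (ac g h j i &&
    (gp a f b e c d && (gp (!a) i (!b) h (!c) g && (gp a j (!d) (!h) (!e) (!g) &&
      (gp b (!j) d (!i) (!f) g && gp c j e i f h))))))))

variable {V : Type*} (X : CCSystem V)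

theorem deg₁ (a b : V) : X.o a b b = false := by
  rw [← X.rot, X.deg]
theorem deg₂ (a b : V) : X.o a b a = false := by
  rw [← X.rot, X.deg₁]

theorem ne_of_o {a b c : V} (h : X.o a b c = true) : a ≠ b ∧ b ≠ c ∧ a ≠ c := by
  refine ⟨?_, ?_, ?_⟩ <;> rintro rfl
  · simp [X.deg] at h
  · simp [X.deg₁] at h
  · simp [X.deg₂] at h

theorem perms {a b c : V} (h : a ≠ b ∧ b ≠ c ∧ a ≠ c) :
    X.o b c a = X.o a b c ∧ X.o c a b = X.o a b c ∧ X.o b a c = !X.o a b c ∧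
      X.o a c b = !X.o a b c ∧ X.o c b a = !X.o a b c := by
  have h1 := X.rot a b c
  have h2 := X.rot b c a
  have h3 := X.swap a b c h.1 h.2.1 h.2.2
  have h4 := X.rot b a c
  have h5 := X.rot a c b
  grind

/-- The orientations of five distinct points are determined by the ten increasing triples, so a
Boolean statement about them need only be tested on the `2 ^ 10` sign patterns that satisfy `valid`.
-/
theorem five {a b c d e : V} (hn : [a, b, c, d, e].Nodup)
    (F : (Fin 5 → Fin 5 → Fin 5 → Bool) → Bool)
    (h : ∀ a b c d e f g h i j : Bool, valid a b c d e f g h i j = true →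
      F (table a b c d e f g h i j) = true) :
    F (fun i j k => X.o (![a, b, c, d, e] i) (![a, b, c, d, e] j) (![a, b, c, d, e] k)) = true := by
  have hn' := hn
  simp only [List.nodup_cons, List.mem_cons, List.not_mem_nil, not_or, or_false] at hn
  obtain ⟨⟨h1, h2, h3, h4⟩, ⟨h5, h6, h7⟩, ⟨h8, h9⟩, h10, -⟩ := hn
  have A1 := X.perms ⟨h1, h5, h2⟩
  have A2 := X.perms ⟨h1, h6, h3⟩
  have A3 := X.perms ⟨h1, h7, h4⟩
  have A4 := X.perms ⟨h2, h8, h3⟩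
  have A5 := X.perms ⟨h2, h9, h4⟩
  have A6 := X.perms ⟨h3, h10, h4⟩
  have A7 := X.perms ⟨h5, h8, h6⟩
  have A8 := X.perms ⟨h5, h9, h7⟩
  have A9 := X.perms ⟨h6, h10, h7⟩
  have A10 := X.perms ⟨h8, h10, h9⟩
  have key : (fun i j k => X.o (![a, b, c, d, e] i) (![a, b, c, d, e] j) (![a, b, c, d, e] k)) =
      table (X.o a b c) (X.o a b d) (X.o a b e) (X.o a c d) (X.o a c e) (X.o a d e) (X.o b c d)
        (X.o b c e) (X.o b d e) (X.o c d e) := by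
    funext i j k
    fin_cases i <;> fin_cases j <;> fin_cases k <;>
      simp [table, X.deg, X.deg₁, X.deg₂, A1, A2, A3, A4, A5, A6, A7, A8, A9, A10]
  rw [key]
  apply h
  have B1 := X.acyclic a b c d (by grind)
  have B2 := X.acyclic a b c e (by grind)
  have B3 := X.acyclic a b d e (by grind)
  have B4 := X.acyclic a c d e (by grind)
  have B5 := X.acyclic b c d e (by grind)
  have C1 := X.gp a b c d e (by grind)
  have C2 := X.gp b a c d e (by grind)
  have C3 := X.gp c a b d e (by grind)
  have C4 := X.gp d a b c e (by grind)
  have C5 := X.gp e a b c d (by grind)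
  simp only [A1, A2, A3, A4, A5, A6, A7, A8, A9, A10] at B1 B2 B3 B4 B5 C1 C2 C3 C4 C5
  clear A1 A2 A3 A4 A5 A6 A7 A8 A9 A10 key
  simp only [valid, Bool.and_eq_true]
  exact ⟨B1, B2, B3, B4, B5, C1, C2, C3, C4, C5⟩

/-- `p` lies in the interior of the triangle `a b c`. -/
abbrev Tri (p a b c : V) : Prop := tri X.o p a b c = true

/-- The segments `a b` and `x y` cross in their relative interiors. -/
abbrev Cr (a b x y : V) : Prop := cross X.o a b x y = true

variable {X}

theorem cross_swap_left (o : V → V → V → Bool) (a b x y : V) :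
    cross o b a x y = cross o a b x y := by
  simp only [cross]; grind

theorem cross_swap_right (o : V → V → V → Bool) (a b x y : V) :
    cross o a b y x = cross o a b x y := by
  simp only [cross]; grind

theorem cross_comm (o : V → V → V → Bool) (a b x y : V) :
    cross o x y a b = cross o a b x y := by
  simp only [cross]; grind

theorem Cr.nodup {a b x y : V} (h : X.Cr a b x y) : [a, b, x, y].Nodup := by
  simp only [Cr, cross, Bool.and_eq_true, Bool.or_eq_true] at h
  have := @ne_of_o _ X
  grind

theorem Tri.nodup {p a b c : V} (h : X.Tri p a b c) : [p, a, b, c].Nodup := by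
  simp only [Tri, tri, Bool.and_eq_true, Bool.or_eq_true] at h
  have := @ne_of_o _ X
  grind

/-- Pasch's axiom modulo 2: the number of sides crossed by `xy` has the parity of the number of its
ends inside the triangle. -/
theorem pasch {x y a b c : V} (hn : [x, y, a, b, c].Nodup) :
    (cross X.o x y a b ^^ cross X.o x y b c ^^ cross X.o x y c a ^^ tri X.o x a b c ^^
      tri X.o y a b c) = false := by
  have := X.five hn (fun o => (cross o 0 1 2 3 ^^ cross o 0 1 3 4 ^^ cross o 0 1 4 2 ^^
    tri o 0 2 3 4 ^^ tri o 1 2 3 4) == false) (by decide +kernel)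
  exact of_decide_eq_true this

/-- The orientation predicate on `Fin 4` with prescribed values on increasing triples. -/
def table₄ (a b c d : Bool) (x y z : Fin 4) : Bool :=
  table a b true c true true d true true true x.castSucc y.castSucc z.castSucc

theorem four {a b c d : V} (hn : [a, b, c, d].Nodup)
    (F : (Fin 4 → Fin 4 → Fin 4 → Bool) → Bool)
    (h : ∀ a b c d : Bool, (!(b == d && d == !c && a != b)) = true →
      F (table₄ a b c d) = true) :
    F (fun i j k => X.o (![a, b, c, d] i) (![a, b, c, d] j) (![a, b, c, d] k)) = true := by
  have hn' := hn
  simp only [List.nodup_cons, List.mem_cons, List.not_mem_nil, not_or, or_false] at hn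
  obtain ⟨⟨h1, h2, h3⟩, ⟨h5, h6⟩, h8, -⟩ := hn
  have A1 := X.perms ⟨h1, h5, h2⟩
  have A2 := X.perms ⟨h1, h6, h3⟩
  have A4 := X.perms ⟨h2, h8, h3⟩
  have A7 := X.perms ⟨h5, h8, h6⟩
  have key : (fun i j k => X.o (![a, b, c, d] i) (![a, b, c, d] j) (![a, b, c, d] k)) =
      table₄ (X.o a b c) (X.o a b d) (X.o a c d) (X.o b c d) := by
    funext i j k
    fin_cases i <;> fin_cases j <;> fin_cases k <;>
      simp [table₄, table, X.deg, X.deg₁, X.deg₂, A1, A2, A4, A7]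
  rw [key]
  apply h
  have B1 := X.acyclic a b c d hn'
  simpa only [A1, A2, A4, A7] using B1

/-- The mirror image. -/
def mirror (X : CCSystem V) : CCSystem V where
  o a b c := X.o b a c
  rot a b c := by rw [X.rot a c b, X.rot b a c]
  deg a b := X.deg a b
  swap a b c h1 h2 h3 := by rw [X.swap a b c h1 h2 h3, Bool.not_not]
  acyclic a b c x h := by
    have := four (X := X) h (fun o => (!(o 1 0 3 == o 2 1 3 && o 2 1 3 == o 0 2 3 &&
      o 1 0 2 != o 1 0 3))) (by decide +kernel)
    exact this
  gp r a b c d h := by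
    have := five X h (fun o => !((o 1 0 2 == o 3 0 4) == (o 1 0 3 != o 2 0 4) &&
      (o 1 0 2 == o 3 0 4) == (o 1 0 4 == o 2 0 3))) (by decide +kernel)
    exact this

@[simp] theorem mirror_tri (p a b c : V) : tri X.mirror.o p a b c = tri X.o p a b c := by
  simp only [tri, mirror]; grind

@[simp] theorem mirror_cross (a b x y : V) : cross X.mirror.o a b x y = cross X.o a b x y := by
  simp only [cross, mirror]; grind

theorem o_swap {a b c : V} (h : X.o a b c = true) : X.o b a c = false := by
  simp [(X.perms (X.ne_of_o h)).2.2.1, h]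

theorem o_or {a b c : V} (h1 : a ≠ b) (h2 : b ≠ c) (h3 : a ≠ c) :
    X.o a b c = true ∨ X.o b a c = true := by
  rw [X.swap a b c h1 h2 h3]; grind

theorem Tri.rot {p a b c : V} (h : X.Tri p a b c) : X.Tri p b c a := by
  simp only [Tri, tri] at *; grind

theorem Tri.swap {p a b c : V} (h : X.Tri p a b c) : X.Tri p b a c := by
  simp only [Tri, tri] at *; grind

theorem Tri.left {p a b c : V} (h : X.Tri p a b c) (h' : X.o a b c = true) :
    X.o a b p = true ∧ X.o b c p = true ∧ X.o c a p = true := by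
  have := X.four h.nodup (fun o => decide (tri o 0 1 2 3 = true → o 1 2 3 = true →
    o 1 2 0 = true ∧ o 2 3 0 = true ∧ o 3 1 0 = true)) (by decide +kernel)
  exact of_decide_eq_true this h h'

theorem tri_of_o {p a b c : V} (h1 : X.o p a b = true) (h2 : X.o p b c = true)
    (h3 : X.o p c a = true) : X.Tri p a b c := by
  simp only [Tri, tri]
  rw [X.rot p a b, X.rot p b c, X.rot p c a, h1, h2, h3]; rfl

theorem Tri.trans {g r c d b : V} (hg : X.Tri g r c d) (hb : X.Tri b r c g) : X.Tri b r c d := by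
  have h1 := hg.nodup
  have h2 := hb.nodup
  have h3 : b ≠ d := by
    rintro rfl
    exact absurd (of_decide_eq_true (X.four h1 (fun o => decide (tri o 0 1 2 3 = true →
      ¬ tri o 3 1 2 0 = true)) (by decide +kernel)) hg) (not_not.2 hb)
  exact of_decide_eq_true (X.five (a := g) (b := r) (c := c) (d := d) (e := b) (by grind)
    (fun o => decide (tri o 0 1 2 3 = true → tri o 4 1 2 0 = true → tri o 4 1 2 3 = true))
    (by decide +kernel)) hg hb

/-- Betweenness in the angular order around `a`, within a half-plane. -/
theorem o_between {a b x y g : V} (h1 : X.o a b x = true) (h2 : X.o a b y = true)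
    (h3 : X.o a x g = true) (h4 : X.o a g y = true) (h5 : X.o a x y = true) :
    X.o a b g = true := by
  have e1 := X.ne_of_o h1
  have e2 := X.ne_of_o h2
  have e3 := X.ne_of_o h3
  have e4 := X.ne_of_o h4
  have e5 := X.ne_of_o h5
  have e6 : b ≠ g := by
    rintro rfl
    rw [← X.rot] at h3
    have := (X.perms e1).2.2.2.1
    grind [X.perms e1, X.perms e3]
  exact of_decide_eq_true (X.five (a := a) (b := b) (c := x) (d := y) (e := g) (by grind)
    (fun o => decide (o 0 1 2 = true → o 0 1 3 = true → o 0 2 4 = true → o 0 4 3 = true →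
      o 0 2 3 = true → o 0 1 4 = true))
    (by decide +kernel)) h1 h2 h3 h4 h5

theorem o_trans {p q x y z : V} (h1 : X.o p q x = true) (h2 : X.o p q y = true)
    (h3 : X.o p q z = true) (h4 : X.o p x y = true) (h5 : X.o p y z = true) :
    X.o p x z = true := by
  have e1 := X.ne_of_o h1
  have e2 := X.ne_of_o h2
  have e3 := X.ne_of_o h3
  have e4 := X.ne_of_o h4
  have e5 := X.ne_of_o h5
  have e6 : x ≠ z := by
    rintro rfl
    grind [X.perms e4, X.perms e5]
  exact of_decide_eq_true (X.five (a := p) (b := q) (c := x) (d := y) (e := z) (by grind)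
    (fun o => decide (o 0 1 2 = true → o 0 1 3 = true → o 0 1 4 = true → o 0 2 3 = true →
      o 0 3 4 = true → o 0 2 4 = true))
    (by decide +kernel)) h1 h2 h3 h4 h5

/-- A triangle on one side of a line has its interior on the same side. -/
theorem Tri.o_left {g r c d a b : V} (hg : X.Tri g r c d) (hr : X.o a b r = true)
    (hc : X.o a b c = true) (hd : X.o a b d = true) : X.o a b g = true := by
  have n := hg.nodup
  have e1 := X.ne_of_o hr
  have e2 := X.ne_of_o hc
  have e3 := X.ne_of_o hd
  have h5 : X.Tri a r c d → False := fun ha =>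
    of_decide_eq_true (X.five (a := a) (b := b) (c := r) (d := c) (e := d) (by grind)
      (fun o => decide (o 0 1 2 = true → o 0 1 3 = true → o 0 1 4 = true →
        tri o 0 2 3 4 = true → False))
      (by decide +kernel)) hr hc hd ha
  by_cases hag : a = g
  · subst hag; exact (h5 hg).elim
  -- Six points are involved, too many for `five`. Seen from `a`, outside the triangle, `g` lies
  -- angularly between two of its vertices, and `o_between` brings in the line `ab`.
  have h6 := of_decide_eq_true (X.five (a := g) (b := r) (c := c) (d := d) (e := a) (by grind)
    (fun o => decide (tri o 0 1 2 3 = true → (tri o 4 1 2 3 = true ∨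
      (o 4 1 0 = true ∧ o 4 0 2 = true ∧ o 4 1 2 = true) ∨
      (o 4 1 0 = true ∧ o 4 0 3 = true ∧ o 4 1 3 = true) ∨
      (o 4 2 0 = true ∧ o 4 0 3 = true ∧ o 4 2 3 = true) ∨
      (o 4 2 0 = true ∧ o 4 0 1 = true ∧ o 4 2 1 = true) ∨
      (o 4 3 0 = true ∧ o 4 0 1 = true ∧ o 4 3 1 = true) ∨
      (o 4 3 0 = true ∧ o 4 0 2 = true ∧ o 4 3 2 = true))))
    (by decide +kernel)) hg
  rcases h6 with h6 | h6 | h6 | h6 | h6 | h6 | h6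
  · exact (h5 h6).elim
  · exact o_between hr hc h6.1 h6.2.1 h6.2.2
  · exact o_between hr hd h6.1 h6.2.1 h6.2.2
  · exact o_between hc hd h6.1 h6.2.1 h6.2.2
  · exact o_between hc hr h6.1 h6.2.1 h6.2.2
  · exact o_between hd hr h6.1 h6.2.1 h6.2.2
  · exact o_between hd hc h6.1 h6.2.1 h6.2.2

theorem tri_of_turn {r c g p : V} (h1 : X.o r c g = true) (h2 : X.o g c p = true)
    (h3 : X.o c r p = true) : X.Tri c r g p := by
  have e1 := X.ne_of_o h1
  have e2 := X.ne_of_o h2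
  have e3 := X.ne_of_o h3
  grind [tri, X.perms e1, X.perms e2, X.perms e3]

theorem tri_of_turn' {r c g p : V} (h1 : X.o r c g = true) (h2 : X.o r g p = true)
    (h3 : X.o c r p = true) : X.Tri r c g p := by
  have e1 := X.ne_of_o h1
  have e2 := X.ne_of_o h2
  have e3 := X.ne_of_o h3
  grind [tri, X.perms e1, X.perms e2, X.perms e3]

/-! ### Extreme points, inner points and hull edges. -/

theorem exists_extreme {A : Finset V} (hA : A.Nonempty) (rel : V → V → Prop)
    (irr : ∀ x ∈ A, ¬ rel x x)
    (tr : ∀ x ∈ A, ∀ y ∈ A, ∀ z ∈ A, rel x y → rel y z → rel x z) :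
    ∃ y ∈ A, ∀ z ∈ A, ¬ rel y z := by
  classical
  obtain ⟨y, hy, hmin⟩ := A.exists_min_image (fun y => (A.filter (rel y)).card) hA
  refine ⟨y, hy, fun z hz hyz => ?_⟩
  have : A.filter (rel z) ⊂ A.filter (rel y) := by
    rw [Finset.ssubset_iff_of_subset]
    · exact ⟨z, by simp [hz, hyz], by simp [irr z hz]⟩
    · intro w
      simp only [Finset.mem_filter]
      exact fun ⟨hw, hzw⟩ => ⟨hw, tr y hy z hz w hw hyz hzw⟩
  exact absurd (Finset.card_lt_card this) (not_lt.2 (hmin z hz))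

/-- By `o_trans` the angular order around `p` is transitive on the half-plane left of `pq`, so a
finite set there has a first element. -/
theorem exists_first {A : Finset V} (hA : A.Nonempty) {p q : V}
    (h : ∀ a ∈ A, X.o p q a = true) :
    ∃ g ∈ A, ∀ z ∈ A, z ≠ g → X.o p g z = true := by
  obtain ⟨g, hg, H⟩ := exists_extreme hA (fun y z => X.o p z y = true)
    (fun x _ => by simp [X.deg₁])
    (fun x hx y hy z hz h1 h2 => o_trans (h z hz) (h y hy) (h x hx) h2 h1)
  refine ⟨g, hg, fun z hz hzg => ?_⟩
  have e1 := X.ne_of_o (h g hg)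
  have e2 := X.ne_of_o (h z hz)
  have := H z hz
  rcases X.o_or (a := p) (b := g) (c := z) (by grind) (by grind) (by grind) with h | h
  · exact h
  · grind [X.perms (X.ne_of_o h)]

variable (X) in
/-- `p` is a point of `T` inside a triangle spanned by `T`. -/
def Inner (T : Finset V) (p : V) : Prop :=
  p ∈ T ∧ ∃ a ∈ T, ∃ b ∈ T, ∃ c ∈ T, X.Tri p a b c

variable (X) in
/-- All other points of `T` lie on the same side of the line `x y`. -/
def HullEdge (T : Finset V) (x y : V) : Prop :=
  ∀ z ∈ T, ∀ w ∈ T, z ≠ x → z ≠ y → w ≠ x → w ≠ y → X.o x y z = X.o x y w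

/-- The angular order around `p` can fail to be transitive only through three points that wind
around `p`, and these would make `p` inner. -/
theorem exists_hull_neighbor {T : Finset V} {p q : V} (hp : p ∈ T) (hi : ¬ X.Inner T p)
    (hq : q ∈ T) (hqp : q ≠ p) :
    ∃ a ∈ T, a ≠ p ∧ ∀ z ∈ T, z ≠ p → z ≠ a → X.o p a z = true := by
  classical
  obtain ⟨g, hg, H⟩ := exists_extreme (A := T.erase p) ⟨q, by simp [hq, hqp]⟩
    (fun y z => X.o p z y = true) (fun x _ => by simp [X.deg₁]) (by
      intro x hx y hy z hz h1 h2
      simp only [Finset.mem_erase] at hx hy hz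
      have e1 := X.ne_of_o h1
      have e2 := X.ne_of_o h2
      have e3 : x ≠ z := by
        rintro rfl
        grind [X.perms e1, X.perms e2]
      rcases X.o_or (a := p) (b := z) (c := x) (by grind) (by grind) (by grind) with h | h
      · exact h
      · refine absurd ⟨hp, x, hx.2, z, hz.2, y, hy.2, tri_of_o ?_ h2 h1⟩ hi
        grind [X.perms (X.ne_of_o h)])
  simp only [Finset.mem_erase] at hg H
  refine ⟨g, hg.2, hg.1, fun z hz hzp hzg => ?_⟩
  rcases X.o_or (a := p) (b := g) (c := z) (by grind) (by grind) (by grind) with h | h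
  · exact h
  · have := H z ⟨hzp, hz⟩
    grind [X.perms (X.ne_of_o h)]

@[simp] theorem mirror_inner {T : Finset V} {p : V} : X.mirror.Inner T p ↔ X.Inner T p := by
  simp [Inner, Tri]

theorem mirror_o {a b c : V} : X.mirror.o a b c = X.o b a c := rfl

theorem HullEdge.symm {T : Finset V} {x y : V} (h : X.HullEdge T x y) : X.HullEdge T y x := by
  intro z hz w hw h1 h2 h3 h4
  by_cases hxy : x = y
  · subst hxy; simp [X.deg]
  · rw [X.swap x y z hxy (by grind) (by grind), X.swap x y w hxy (by grind) (by grind),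
      h z hz w hw h2 h1 h4 h3]

@[simp] theorem mirror_hullEdge {T : Finset V} {x y : V} :
    X.mirror.HullEdge T x y ↔ X.HullEdge T x y :=
  ⟨fun h => HullEdge.symm (X := X) fun z hz w hw h1 h2 h3 h4 => h z hz w hw h2 h1 h4 h3,
   fun h z hz w hw h1 h2 h3 h4 => h.symm z hz w hw h2 h1 h4 h3⟩

theorem exists_hull_neighbor' {T : Finset V} {p q : V} (hp : p ∈ T) (hi : ¬ X.Inner T p)
    (hq : q ∈ T) (hqp : q ≠ p) :
    ∃ a ∈ T, a ≠ p ∧ ∀ z ∈ T, z ≠ p → z ≠ a → X.o a p z = true :=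
  exists_hull_neighbor (X := X.mirror) hp (by simpa) hq hqp

theorem hullEdge_of_forall {T : Finset V} {p a : V}
    (h : ∀ z ∈ T, z ≠ p → z ≠ a → X.o p a z = true) : X.HullEdge T p a :=
  fun z hz w hw h1 h2 h3 h4 => by rw [h z hz h1 h2, h w hw h3 h4]

/-- If `x` is inside a triangle, the line `xy` has vertices of it on both sides. The case `x = y`
must be excluded because `HullEdge T x x` always holds, `o x x` being constantly false. -/
theorem HullEdge.not_inner {T : Finset V} {x y : V} (hxy : x ≠ y)
    (h : X.HullEdge T x y) : ¬ X.Inner T x := by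
  rintro ⟨hx, a, ha, b, hb, c, hc, ht⟩
  have n := ht.nodup
  simp only [List.nodup_cons, List.mem_cons, List.not_mem_nil, not_or, or_false] at n
  obtain ⟨⟨n1, n2, n3⟩, ⟨n4, n5⟩, n6, -⟩ := n
  have key : ∀ {a b c}, a ∈ T → b ∈ T → x ≠ a → x ≠ b → a ≠ y → b ≠ y → a ≠ b → x ≠ c →
      X.Tri x y a b → False := by
    intro a b c ha hb h1 h2 h3 h4 h5 h6 ht
    have := h a ha b hb (Ne.symm h1) h3 (Ne.symm h2) h4
    exact of_decide_eq_true (X.four ht.nodup (fun o => decide (tri o 0 1 2 3 = true →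
      ¬ o 0 1 2 = o 0 1 3)) (by decide +kernel)) ht this
  by_cases h1 : y = a
  · subst h1; exact key hb hc n2 n3 (by grind) (by grind) (by grind) n1 ht
  by_cases h2 : y = b
  · subst h2; exact key hc ha n3 n1 (by grind) (by grind) (by grind) n1 ht.rot
  by_cases h3 : y = c
  · subst h3; exact key ha hb n1 n2 (by grind) (by grind) (by grind) n1 ht.rot.rot
  have e1 := h a ha b hb (by grind) (by grind) (by grind) (by grind)
  have e2 := h b hb c hc (by grind) (by grind) (by grind) (by grind)
  exact of_decide_eq_true (X.five (a := x) (b := y) (c := a) (d := b) (e := c) (by grind)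
    (fun o => decide (o 0 1 2 = o 0 1 3 → o 0 1 3 = o 0 1 4 → ¬ tri o 0 2 3 4 = true))
    (by decide +kernel)) e1 e2 ht

theorem HullEdge.not_inner_right {T : Finset V} {x y : V} (hxy : x ≠ y)
    (h : X.HullEdge T x y) : ¬ X.Inner T y := h.symm.not_inner hxy.symm

theorem Inner.mono {T T' : Finset V} (hT : T ⊆ T') {p : V} (h : X.Inner T p) : X.Inner T' p := by
  obtain ⟨hp, a, ha, b, hb, c, hc, ht⟩ := h
  exact ⟨hT hp, a, hT ha, b, hT hb, c, hT hc, ht⟩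

/-! ### Obstacles and the sweep of a triangle. -/

/-- The spoke lemmas treat obstacles that start at a vertex of the triangle `r c d` or at `g`, where
`pasch` does not apply because its five points must be distinct. -/
theorem spoke_first {r c d g b : V} (h0 : X.o r c d = true) (hg : X.Tri g r c d)
    (hb : X.Cr c b r g) : X.o r c b = true ∧ X.o c d b = true := by
  have n1 := hg.nodup
  have n2 := hb.nodup
  by_cases hbd : b = d
  · subst hbd
    exact (of_decide_eq_true (X.four (a := g) (b := r) (c := c) (d := b) (by grind)
      (fun o => decide (tri o 0 1 2 3 = true → cross o 2 3 1 0 = true → False))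
      (by decide +kernel)) hg hb).elim
  · exact of_decide_eq_true (X.five (a := g) (b := r) (c := c) (d := d) (e := b) (by grind)
      (fun o => decide (o 1 2 3 = true → tri o 0 1 2 3 = true → cross o 2 4 1 0 = true →
        o 1 2 4 = true ∧ o 2 3 4 = true)) (by decide +kernel)) h0 hg hb

theorem not_spokes {r c d g b : V} (hg : X.Tri g r c d) (h1 : X.Cr d b r g)
    (h2 : X.Cr d b c g) : False := by
  have n1 := hg.nodup
  have n2 := h1.nodup
  have n3 := h2.nodup
  exact of_decide_eq_true (X.five (a := g) (b := r) (c := c) (d := d) (e := b) (by grind)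
      (fun o => decide (tri o 0 1 2 3 = true → cross o 3 4 1 0 = true → cross o 3 4 2 0 = true →
        False)) (by decide +kernel)) hg h1 h2

/-- Here `a` lies in the wedge at `g` opposite to the triangle `r c g`. -/
theorem not_cross_of_between {r c g a b : V} (h0 : X.o r c g = true) (h : X.o g c a = true)
    (h' : X.o r g a = true) (h1 : X.Cr a b r g) (h2 : X.Cr a b c g) : False := by
  have n1 := X.ne_of_o h0
  have n2 := h1.nodup
  have n3 := h2.nodup
  exact of_decide_eq_true (X.five (a := r) (b := c) (c := g) (d := a) (e := b) (by grind)
      (fun o => decide (o 0 1 2 = true → o 2 1 3 = true → o 0 2 3 = true →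
        cross o 3 4 0 2 = true → cross o 3 4 1 2 = true →
        False)) (by decide +kernel)) h0 h h' h1 h2

theorem spoke_second {r c d g b : V} (h0 : X.o r c d = true) (hg : X.Tri g r c d)
    (hb : X.Cr r b c g) : X.Cr r b c d ∨ (X.Tri b r c d ∧ X.o r g b = false) := by
  have n1 := hg.nodup
  have n2 := hb.nodup
  by_cases hbd : b = d
  · subst hbd
    exact (of_decide_eq_true (X.four (a := g) (b := r) (c := c) (d := b) (by grind)
      (fun o => decide (tri o 0 1 2 3 = true → cross o 1 3 2 0 = true → False))
      (by decide +kernel)) hg hb).elim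
  · exact of_decide_eq_true (X.five (a := g) (b := r) (c := c) (d := d) (e := b) (by grind)
      (fun o => decide (o 1 2 3 = true → tri o 0 1 2 3 = true → cross o 1 4 2 0 = true →
        cross o 1 4 2 3 = true ∨ (tri o 4 1 2 3 = true ∧ o 1 0 4 = false)))
        (by decide +kernel)) h0 hg hb

theorem spoke_third {r c d g y : V} (h0 : X.o r c d = true) (hg : X.Tri g r c d)
    (hy : X.o g r y = true) (hyc : y ≠ c) : X.Cr g y r c ∨ X.Cr g y c d ∨ X.Tri y r c d := by
  have n1 := hg.nodup
  have n2 := X.ne_of_o hy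
  have hyd : y ≠ d := by
    rintro rfl
    have := hg.left h0
    grind [X.perms (X.ne_of_o hy), X.perms (X.ne_of_o h0)]
  exact of_decide_eq_true (X.five (a := g) (b := r) (c := c) (d := d) (e := y) (by grind)
      (fun o => decide (o 1 2 3 = true → tri o 0 1 2 3 = true → o 0 1 4 = true →
        cross o 0 4 1 2 = true ∨ cross o 0 4 2 3 = true ∨ tri o 4 1 2 3 = true))
        (by decide +kernel)) h0 hg hy

theorem Cr.swap_left {a b x y : V} (h : X.Cr a b x y) : X.Cr b a x y := by
  rwa [Cr, cross_swap_left]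

theorem Cr.swap_right {a b x y : V} (h : X.Cr a b x y) : X.Cr a b y x := by
  rwa [Cr, cross_swap_right]

theorem Cr.symm {a b x y : V} (h : X.Cr a b x y) : X.Cr x y a b := by
  rwa [Cr, cross_comm]

theorem Cr.cases_tri {r c g a b : V} (h : X.Cr a b r g) (hc1 : a ≠ c) (hc2 : b ≠ c)
    (hc : r ≠ c) (hg : c ≠ g) : X.Cr a b r c ∨ X.Cr a b c g ∨ X.Tri a r c g ∨ X.Tri b r c g := by
  have n := h.nodup
  have := pasch (X := X) (x := a) (y := b) (a := r) (b := c) (c := g) (by grind)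
  rw [cross_swap_right _ _ _ r g] at this
  simp only [Cr, Tri] at *
  grind

variable (X) in
/-- The segment `x y` crosses no segment of `Obs`. -/
def Unc (Obs : V → V → Prop) (x y : V) : Prop := ∀ a b, Obs a b → ¬ X.Cr a b x y

theorem Unc.symm {Obs : V → V → Prop} {x y : V} (h : X.Unc Obs x y) : X.Unc Obs y x :=
  fun a b hab hc => h a b hab hc.swap_right

section step

variable {T : Finset V} {Obs : V → V → Prop} {r c d g : V}

theorem Tri.not_left {g r c b : V} (hb : X.Tri b r c g) (h0 : X.o r c g = true) :
    ¬ X.o r g b = true := by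
  have := (hb.left h0).2.2
  have := X.perms (X.ne_of_o this)
  grind

/-- As `g` comes first around `r`, the triangle `r c g` contains no point of `T`. An obstacle across
`rg` therefore leaves it through `cg` and enters the triangle `c d g`. There it can neither cross
`cd`, nor leave through `dg` (it would separate `g` from `r`, `c`, `d`), nor end inside. -/
theorem unc_first (hO : ∀ a b, Obs a b → Obs b a ∧ a ∈ T) (hrc : X.Unc Obs r c)
    (hcd : X.Unc Obs c d) (h0 : X.o r c d = true)
    (hang : ∀ y, Obs c y → ¬ (X.o r c y = true ∧ X.o c d y = true)) (hg : X.Tri g r c d)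
    (hfirst : ∀ p ∈ T, X.Tri p r c d → p ≠ g → X.o r g p = true) :
    X.Unc Obs r g := by
  have n := hg.nodup
  have hl := hg.left h0
  have main : ∀ a b, Obs a b → X.o r g a = true → X.Cr a b r g → False := by
    intro a b hab hga hcr
    have n2 := hcr.nodup
    have hgb : ¬ X.o r g b = true := by
      intro h
      have := X.perms (X.ne_of_o h)
      have := X.perms (X.ne_of_o hga)
      simp only [Cr, cross] at hcr
      grind
    have hac : a ≠ c := by
      rintro rfl
      exact hang b hab (spoke_first h0 hg hcr)
    have hbc : b ≠ c := by
      rintro rfl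
      exact hang a (hO _ _ hab).1 (spoke_first h0 hg hcr.swap_left)
    have hcg : X.Cr a b c g := by
      rcases hcr.cases_tri hac hbc (by grind) (by grind) with h | h | h | h
      · exact (hrc a b hab h).elim
      · exact h
      · exact (h.not_left hl.1 hga).elim
      · exact (hgb (hfirst b (hO _ _ (hO _ _ hab).1).2 (hg.trans h) (by grind))).elim
    have had : a ≠ d := by
      rintro rfl
      exact not_spokes hg hcr hcg
    have hbd : b ≠ d := by
      rintro rfl
      exact not_spokes hg hcr.swap_left hcg.swap_left
    rcases hcg.cases_tri had hbd (by grind) (by grind) with h | h | h | h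
    · exact hcd a b hab h
    · have s1 : X.o a b r = X.o a b c ∧ X.o a b r = X.o a b d ∧ X.o a b g = !X.o a b r := by
        have f1 := X.perms (a := a) (b := b) (c := r) (by grind)
        have f2 := X.perms (a := a) (b := b) (c := c) (by grind)
        have f3 := X.perms (a := a) (b := b) (c := d) (by grind)
        have f4 := X.perms (a := a) (b := b) (c := g) (by grind)
        simp only [Cr, cross] at h hcr hcg
        grind
      have f1 := X.swap a b r (by grind) (by grind) (by grind)
      have f2 := X.swap a b c (by grind) (by grind) (by grind)
      have f3 := X.swap a b d (by grind) (by grind) (by grind)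
      have f4 := X.swap a b g (by grind) (by grind) (by grind)
      have g1 := hg.o_left (a := a) (b := b)
      have g2 := hg.o_left (a := b) (b := a)
      grind
    · refine not_cross_of_between hl.1 ?_ hga hcr hcg
      exact (h.left hl.2.1).2.2
    · exact hgb (hfirst b (hO _ _ (hO _ _ hab).1).2
        (hg.rot.trans h).rot.rot (by grind))
  intro a b hab hcr
  have n2 := hcr.nodup
  rcases X.o_or (a := r) (b := g) (c := a) (by grind) (by grind) (by grind) with h | h
  · exact main a b hab h hcr
  · refine main b a (hO _ _ hab).1 ?_ hcr.swap_left
    have e1 := X.perms (X.ne_of_o h)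
    have e2 := X.perms (a := r) (b := g) (c := b) (by grind)
    simp only [Cr, cross] at hcr
    grind

/-- The triangle `r c g` is empty and its sides `rc` and `rg` are uncrossed, so by `pasch` an
obstacle can meet `cg` only if it starts at `r`; that case is `spoke_second`. -/
theorem unc_second (hO : ∀ a b, Obs a b → Obs b a ∧ a ∈ T) (hrc : X.Unc Obs r c)
    (hcd : X.Unc Obs c d) (h0 : X.o r c d = true) (hg : X.Tri g r c d)
    (hfirst : ∀ p ∈ T, X.Tri p r c d → p ≠ g → X.o r g p = true) (hrg : X.Unc Obs r g) :
    X.Unc Obs c g := by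
  have n := hg.nodup
  have hl := hg.left h0
  have main : ∀ b, Obs r b → X.Cr r b c g → False := by
    intro b hab hcr
    have n2 := hcr.nodup
    rcases spoke_second h0 hg hcr with h | h
    · exact hcd _ _ hab h
    · have := hfirst b (hO _ _ (hO _ _ hab).1).2 h.1 (by grind)
      grind
  intro a b hab hcr
  have n2 := hcr.nodup
  have har : a ≠ r := by rintro rfl; exact main b hab hcr
  have hbr : b ≠ r := by rintro rfl; exact main a (hO _ _ hab).1 hcr.swap_left
  rcases hcr.cases_tri har hbr (by grind) (by grind) with h | h | h | h
  · exact hrc a b hab h.swap_right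
  · exact hrg a b hab h
  · exact h.swap.not_left hl.1 (hfirst a (hO _ _ hab).2 (hg.trans h.swap) (by grind))
  · exact h.swap.not_left hl.1
      (hfirst b (hO _ _ (hO _ _ hab).1).2 (hg.trans h.swap) (by grind))

/-- An obstacle leaving `g` to the right of `rg` would cross `rc` or `cd`, end at `c` against
`hang`, or end at a point of the triangle that precedes `g`. -/
theorem left_of_first (hO : ∀ a b, Obs a b → Obs b a ∧ a ∈ T) (hrc : X.Unc Obs r c)
    (hcd : X.Unc Obs c d) (h0 : X.o r c d = true)
    (hang : ∀ y, Obs c y → ¬ (X.o r c y = true ∧ X.o c d y = true)) (hg : X.Tri g r c d)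
    (hfirst : ∀ p ∈ T, X.Tri p r c d → p ≠ g → X.o r g p = true) {y : V} (hy : Obs g y)
    (hyr : y ≠ r) (hyg : y ≠ g) : X.o r g y = true := by
  have n := hg.nodup
  have hl := hg.left h0
  have hyc : y ≠ c := by
    rintro rfl
    exact hang g (hO _ _ hy).1 ⟨hl.1, hl.2.1⟩
  rcases X.o_or (a := r) (b := g) (c := y) (by grind) (by grind) (by grind) with h | h
  · exact h
  · rcases spoke_third h0 hg h hyc with h' | h' | h'
    · exact (hrc _ _ hy h').elim
    · exact (hcd _ _ hy h').elim
    · exact hfirst y (hO _ _ (hO _ _ hy).1).2 h' hyg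

theorem unc_of_empty (hO : ∀ a b, Obs a b → Obs b a ∧ a ∈ T) (hrc : X.Unc Obs r c)
    (hcd : X.Unc Obs c d) (h0 : X.o r c d = true)
    (hang : ∀ y, Obs c y → ¬ (X.o r c y = true ∧ X.o c d y = true))
    (hemp : ∀ p ∈ T, ¬ X.Tri p r c d) : X.Unc Obs r d := by
  have n := X.ne_of_o h0
  have main : ∀ b, Obs c b → X.Cr c b r d → False := by
    intro b hab hcr
    have n2 := hcr.nodup
    refine hang b hab ?_
    exact of_decide_eq_true (X.four (a := r) (b := c) (c := d) (d := b) (by grind)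
      (fun o => decide (o 0 1 2 = true → cross o 1 3 0 2 = true → o 0 1 3 = true ∧
        o 1 2 3 = true)) (by decide +kernel)) h0 hcr
  intro a b hab hcr
  have n2 := hcr.nodup
  have hac : a ≠ c := by rintro rfl; exact main b hab hcr
  have hbc : b ≠ c := by rintro rfl; exact main a (hO _ _ hab).1 hcr.swap_left
  rcases hcr.cases_tri hac hbc (by grind) (by grind) with h | h | h | h
  · exact hrc a b hab h
  · exact hcd a b hab h
  · exact hemp a (hO _ _ hab).2 h
  · exact hemp b (hO _ _ (hO _ _ hab).1).2 h

/-- Sweeping the triangle `r c d` from a segment `r c` that crosses no obstacle. -/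
theorem sweep (hO : ∀ a b, Obs a b → Obs b a ∧ a ∈ T) (hrc : X.Unc Obs r c)
    (hcd : X.Unc Obs c d) (h0 : X.o r c d = true)
    (hang : ∀ y, Obs c y → ¬ (X.o r c y = true ∧ X.o c d y = true)) :
    X.Unc Obs r d ∨ ∃ g ∈ T, X.Tri g r c d ∧ X.o r c g = true ∧ X.Unc Obs r g ∧ X.Unc Obs c g ∧
      ∀ y, Obs g y → y ≠ r → y ≠ g → X.o r g y = true := by
  classical
  by_cases hemp : ∀ p ∈ T, ¬ X.Tri p r c d
  · exact .inl (unc_of_empty hO hrc hcd h0 hang hemp)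
  · push Not at hemp
    obtain ⟨p, hp, hpt⟩ := hemp
    obtain ⟨g, hg, hfirst⟩ := exists_first (X := X) (A := T.filter fun p => X.Tri p r c d)
      (p := r) (q := c) ⟨p, by simpa [hp] using hpt⟩ (fun a ha => by
        simp only [Finset.mem_filter] at ha
        exact (ha.2.left h0).1)
    simp only [Finset.mem_filter, and_imp] at hg hfirst
    have h1 := unc_first hO hrc hcd h0 hang hg.2 hfirst
    exact .inr ⟨g, hg.1, hg.2, (hg.2.left h0).1, h1, unc_second hO hrc hcd h0 hg.2 hfirst h1,
      fun y hy hyr hyg => left_of_first hO hrc hcd h0 hang hg.2 hfirst hy hyr hyg⟩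

end step

/-! ### Consecutive pairs in lists. -/

section lists

/-- `b` comes right after `a` in the list. -/
def Nx : List V → V → V → Prop
  | x :: y :: l, a, b => (a = x ∧ b = y) ∨ Nx (y :: l) a b
  | _, _, _ => False

/-- `a` and `b` are consecutive in the list, in one order or the other. -/
def Adj (l : List V) (a b : V) : Prop := Nx l a b ∨ Nx l b a

@[simp] theorem nx_nil (a b : V) : ¬ Nx [] a b := by simp [Nx]
@[simp] theorem nx_singleton (x a b : V) : ¬ Nx [x] a b := by simp [Nx]
@[simp] theorem nx_cons_cons (x y : V) (l : List V) (a b : V) :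
    Nx (x :: y :: l) a b ↔ (a = x ∧ b = y) ∨ Nx (y :: l) a b := by rw [Nx]

theorem Adj.symm {l : List V} {a b : V} (h : Adj l a b) : Adj l b a := Or.symm h

theorem nx_append (A : List V) (v : V) (B : List V) (a b : V) :
    Nx (A ++ v :: B) a b ↔ Nx (A ++ [v]) a b ∨ Nx (v :: B) a b := by
  induction A with
  | nil => simp
  | cons x A ih =>
    cases A with
    | nil => simp
    | cons y A => simp only [List.cons_append, nx_cons_cons] at ih ⊢; rw [ih, or_assoc]

theorem nx_reverse (l : List V) (a b : V) : Nx l.reverse a b ↔ Nx l b a := by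
  induction l with
  | nil => simp
  | cons x l ih =>
    cases l with
    | nil => simp
    | cons y l =>
      rw [nx_cons_cons, ← ih]
      simp only [List.reverse_cons, List.append_assoc, List.cons_append, List.nil_append]
      rw [nx_append]
      simp only [nx_cons_cons, nx_singleton]
      tauto

theorem adj_append (A : List V) (v : V) (B : List V) (a b : V) :
    Adj (A ++ v :: B) a b ↔ Adj (A ++ [v]) a b ∨ Adj (v :: B) a b := by
  simp only [Adj, nx_append A v B]; tauto

@[simp] theorem adj_cons_cons (x y : V) (l : List V) (a b : V) :
    Adj (x :: y :: l) a b ↔ (a = x ∧ b = y) ∨ (a = y ∧ b = x) ∨ Adj (y :: l) a b := by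
  simp only [Adj, nx_cons_cons]; tauto

@[simp] theorem adj_nil (a b : V) : ¬ Adj [] a b := by simp [Adj]
@[simp] theorem adj_singleton (x a b : V) : ¬ Adj [x] a b := by simp [Adj]

@[simp] theorem adj_reverse (l : List V) (a b : V) : Adj l.reverse a b ↔ Adj l a b := by
  simp only [Adj, nx_reverse]; tauto

theorem adj_append_append (A : List V) (u v : V) (B : List V) (a b : V) :
    Adj (A ++ u :: v :: B) a b ↔
      Adj (A ++ [u]) a b ∨ (a = u ∧ b = v) ∨ (a = v ∧ b = u) ∨ Adj (v :: B) a b := by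
  rw [adj_append, adj_cons_cons]

theorem nx_iff (l : List V) (a b : V) : Nx l a b ↔ ∃ A B, l = A ++ a :: b :: B := by
  constructor
  · intro h
    induction l with
    | nil => simp at h
    | cons x l ih =>
      cases l with
      | nil => simp at h
      | cons y l =>
        rw [nx_cons_cons] at h
        rcases h with ⟨rfl, rfl⟩ | h
        · exact ⟨[], l, rfl⟩
        · obtain ⟨A, B, h⟩ := ih h
          exact ⟨x :: A, B, by rw [h]; rfl⟩
  · rintro ⟨A, B, rfl⟩
    rw [nx_append]
    simp

theorem Nx.mem {l : List V} {a b : V} (h : Nx l a b) : a ∈ l ∧ b ∈ l := by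
  obtain ⟨A, B, rfl⟩ := (nx_iff _ _ _).1 h
  simp

theorem Adj.mem {l : List V} {a b : V} (h : Adj l a b) : a ∈ l ∧ b ∈ l :=
  h.elim Nx.mem fun h => h.mem.symm

theorem Adj.ne {l : List V} (hl : l.Nodup) {a b : V} (h : Adj l a b) : a ≠ b := by
  rcases h with h | h <;> obtain ⟨A, B, rfl⟩ := (nx_iff _ _ _).1 h <;>
    simp only [List.nodup_append, List.nodup_cons, List.mem_cons] at hl <;> grind

theorem adj_of_append_left {A B : List V} {a b : V} (h : Adj A a b) : Adj (A ++ B) a b := by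
  rcases B with _ | ⟨v, B⟩
  · simpa
  · rcases A.eq_nil_or_concat with rfl | ⟨A, u, rfl⟩
    · simp at h
    · rw [List.concat_eq_append] at h ⊢
      simp only [List.append_assoc, List.cons_append, List.nil_append]
      rw [adj_append_append]
      exact .inl h

theorem adj_of_append_right {A B : List V} {a b : V} (h : Adj B a b) : Adj (A ++ B) a b := by
  rcases B with _ | ⟨v, B⟩
  · simp at h
  · rw [adj_append]; exact .inr h

theorem split_unique {A B C D : List V} {c : V} (hn : (A ++ c :: B).Nodup)
    (h : A ++ c :: B = C ++ c :: D) : A = C ∧ B = D := by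
  induction A generalizing C with
  | nil =>
    rcases C with _ | ⟨x, C⟩
    · simpa using h
    · simp only [List.nil_append, List.cons_append, List.cons.injEq] at h hn
      simp [h.2] at hn
  | cons x A ih =>
    rcases C with _ | ⟨x', C⟩
    · simp only [List.nil_append, List.cons_append, List.cons.injEq] at h hn
      simp [h.1] at hn
    · simp only [List.cons_append, List.cons.injEq, List.nodup_cons] at h hn
      have := ih hn.2 h.2
      simp [h.1, this]

/-- In a list without repetitions, the neighbours of an element. -/
theorem adj_mid {A B : List V} {c y : V} (hn : (A ++ c :: B).Nodup) :
    Adj (A ++ c :: B) c y ↔ (∃ A', A = A' ++ [y]) ∨ ∃ B', B = y :: B' := by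
  constructor
  · rintro (h | h) <;> obtain ⟨C, D, h⟩ := (nx_iff _ _ _).1 h
    · exact .inr ⟨D, (split_unique hn h).2⟩
    · have h' : A ++ c :: B = (C ++ [y]) ++ c :: D := by simp [h]
      exact .inl ⟨C, (split_unique hn h').1⟩
  · rintro (⟨A', rfl⟩ | ⟨B', rfl⟩)
    · refine .inr ((nx_iff _ _ _).2 ⟨A', B, by simp⟩)
    · exact .inl ((nx_iff _ _ _).2 ⟨A, B', rfl⟩)

theorem exists_adj {l : List V} {c : V} (hc : c ∈ l) (hl : 2 ≤ l.length) : ∃ y, Adj l c y := by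
  obtain ⟨A, B, rfl⟩ := List.append_of_mem hc
  rcases B with _ | ⟨y, B⟩
  · rcases A.eq_nil_or_concat with rfl | ⟨A, u, rfl⟩
    · simp at hl
    · exact ⟨u, .inr ((nx_iff _ _ _).2 ⟨A, [], by simp⟩)⟩
  · exact ⟨y, .inl ((nx_iff _ _ _).2 ⟨A, B, rfl⟩)⟩

open Classical in
/-- The number of consecutive pairs satisfying `P`. -/
noncomputable def cnt (P : V → V → Prop) : List V → ℕ
  | x :: y :: l => (if P x y then 1 else 0) + cnt P (y :: l)
  | _ => 0

open Classical in
@[simp] theorem cnt_cons_cons (P : V → V → Prop) (x y : V) (l : List V) :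
    cnt P (x :: y :: l) = (if P x y then 1 else 0) + cnt P (y :: l) := by rw [cnt]
@[simp] theorem cnt_singleton (P : V → V → Prop) (x : V) : cnt P [x] = 0 := by simp [cnt]
@[simp] theorem cnt_nil (P : V → V → Prop) : cnt P [] = 0 := by simp [cnt]

theorem cnt_append (P : V → V → Prop) (A : List V) (v : V) (B : List V) :
    cnt P (A ++ v :: B) = cnt P (A ++ [v]) + cnt P (v :: B) := by
  induction A with
  | nil => simp
  | cons x A ih =>
    cases A with
    | nil => simp
    | cons y A => simp only [List.cons_append, cnt_cons_cons] at ih ⊢; rw [ih, add_assoc]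

theorem cnt_reverse (P : V → V → Prop) (hP : ∀ x y, P x y → P y x) (l : List V) :
    cnt P l.reverse = cnt P l := by
  induction l with
  | nil => simp
  | cons x l ih =>
    cases l with
    | nil => simp
    | cons y l =>
      rw [cnt_cons_cons, ← ih]
      simp only [List.reverse_cons, List.append_assoc, List.cons_append, List.nil_append]
      rw [cnt_append]
      simp only [cnt_cons_cons, cnt_singleton]
      have : P y x ↔ P x y := ⟨hP _ _, hP _ _⟩
      by_cases h : P x y
      · simp only [h, this.2 h]; omega
      · simp only [h, mt this.1 h]; omega

theorem cnt_le_length (P : V → V → Prop) (l : List V) : cnt P l ≤ l.length := by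
  induction l with
  | nil => simp
  | cons x l ih =>
    cases l with
    | nil => simp
    | cons y l => rw [cnt_cons_cons]; simp only [List.length_cons] at *; split_ifs <;> omega

theorem cnt_eq_zero (P : V → V → Prop) {l : List V} (h : ∀ x y, Nx l x y → ¬ P x y) :
    cnt P l = 0 := by
  induction l with
  | nil => simp
  | cons x l ih =>
    cases l with
    | nil => simp
    | cons y l =>
      rw [cnt_cons_cons, ih fun a b hab => h a b (by simp [hab]), if_neg (h x y (by simp))]

end lists

/-! ### Plane lists and reversals of final stretches. -/

variable (X) in
/-- No two segments between consecutive points of the list cross. -/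
def Plane (l : List V) : Prop := ∀ a b c d, Adj l a b → Adj l c d → ¬ X.Cr a b c d

theorem Plane.mono {l l' : List V} (h : X.Plane l) (hs : ∀ a b, Adj l' a b → Adj l a b) :
    X.Plane l' := fun a b c d h1 h2 => h a b c d (hs _ _ h1) (hs _ _ h2)

theorem Plane.of_append_right {A B : List V} (h : X.Plane (A ++ B)) : X.Plane B :=
  h.mono fun _ _ => adj_of_append_right

theorem Plane.reverse {l : List V} (h : X.Plane l) : X.Plane l.reverse :=
  h.mono fun _ _ => (adj_reverse _ _ _).1

/-- Adding a segment that crosses nothing. -/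
theorem Plane.insert {l l' : List V} {x y : V} (h : X.Plane l) (hu : X.Unc (Adj l) x y)
    (hs : ∀ a b, Adj l' a b → Adj l a b ∨ (a = x ∧ b = y) ∨ (a = y ∧ b = x)) : X.Plane l' := by
  have hxy : ∀ p q : V, X.Cr p q p q → False := fun p q h => by have := h.nodup; grind
  have hxy' : ∀ p q : V, X.Cr p q q p → False := fun p q h => by have := h.nodup; grind
  intro a b c d h1 h2 hc
  rcases hs _ _ h1 with h1 | ⟨rfl, rfl⟩ | ⟨rfl, rfl⟩ <;>
    rcases hs _ _ h2 with h2 | ⟨rfl, rfl⟩ | ⟨rfl, rfl⟩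
  · exact h _ _ _ _ h1 h2 hc
  · exact hu _ _ h1 hc
  · exact hu _ _ h1 hc.swap_right
  · exact hu _ _ h2 hc.symm
  · exact hxy _ _ hc
  · exact hxy' _ _ hc
  · exact hu _ _ h2 hc.symm.swap_right
  · exact hxy' _ _ hc
  · exact hxy _ _ hc

variable (X) in
/-- Reversing a final stretch of a plane list. -/
def Step (l l' : List V) : Prop :=
  X.Plane l ∧ X.Plane l' ∧ ∃ A v B, l = A ++ v :: B ∧ l' = A ++ v :: B.reverse

variable (X) in
/-- Reachability by reversing final stretches. -/
def Reach : List V → List V → Prop := Relation.ReflTransGen X.Step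

theorem Step.symm {l l' : List V} (h : X.Step l l') : X.Step l' l := by
  obtain ⟨h1, h2, A, v, B, rfl, rfl⟩ := h
  exact ⟨h2, h1, A, v, B.reverse, rfl, by simp⟩

theorem Reach.symm {l l' : List V} (h : X.Reach l l') : X.Reach l' l := by
  induction h with
  | refl => exact .refl
  | tail _ h ih => exact .head h.symm ih

theorem Reach.trans {l l' l'' : List V} (h : X.Reach l l') (h' : X.Reach l' l'') :
    X.Reach l l'' := Relation.ReflTransGen.trans h h'

theorem Step.perm {l l' : List V} (h : X.Step l l') : l.Perm l' := by
  obtain ⟨-, -, A, v, B, rfl, rfl⟩ := h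
  exact ((B.reverse_perm.symm).cons v).append_left A

theorem Reach.perm {l l' : List V} (h : X.Reach l l') : l.Perm l' := by
  induction h with
  | refl => exact .refl _
  | tail _ h ih => exact ih.trans h.perm

theorem Reach.plane {l l' : List V} (h : X.Reach l l') (hl : X.Plane l) : X.Plane l' := by
  induction h with
  | refl => exact hl
  | tail _ h ih => exact h.2.1

theorem Step.cons {v : V} {B l' : List V} (h : X.Step (v :: B) l') : ∃ B', l' = v :: B' := by
  obtain ⟨-, -, A, w, C, h, rfl⟩ := h
  rcases A with _ | ⟨x, A⟩
  · simp only [List.nil_append, List.cons.injEq] at h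
    exact ⟨_, by rw [h.1]; rfl⟩
  · simp only [List.cons_append, List.cons.injEq] at h
    exact ⟨_, by rw [h.1]; rfl⟩

theorem Reach.cons {v : V} {B l' : List V} (h : X.Reach (v :: B) l') : ∃ B', l' = v :: B' := by
  induction h with
  | refl => exact ⟨_, rfl⟩
  | tail _ h ih => obtain ⟨B', rfl⟩ := ih; exact h.cons

/-- Reversing a final stretch behind `v` is also a reversal in the list prefixed by `A`; only
planarity of the intermediate lists is at stake, and `hA` grants it for every plane reordering. -/
theorem Reach.lift {A B B' : List V} {v : V} (h : X.Reach (v :: B) (v :: B'))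
    (hB : X.Plane (v :: B))
    (hA : ∀ C, (v :: C).Perm (v :: B) → X.Plane (v :: C) → X.Plane (A ++ v :: C)) :
    X.Reach (A ++ v :: B) (A ++ v :: B') := by
  generalize hl : v :: B' = l at h
  induction h generalizing B' with
  | refl => obtain ⟨-, rfl⟩ := List.cons.inj hl; exact .refl
  | @tail m n hm h ih =>
    obtain ⟨C, rfl⟩ := Reach.cons hm
    refine (ih rfl).tail ?_
    subst hl
    refine ⟨hA _ (Reach.perm hm).symm h.1,
      hA _ ((Reach.perm hm).trans h.perm).symm h.2.1, ?_⟩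
    obtain ⟨-, -, D, w, E, h1, h2⟩ := h
    exact ⟨A ++ D, w, E, by rw [h1, List.append_assoc], by rw [h2, List.append_assoc]⟩

theorem adj_flip (A : List V) (v : V) (B : List V) (t : V) (a b : V) :
    Adj (A ++ v :: t :: B.reverse) a b → Adj (A ++ v :: (B ++ [t])) a b ∨
      (a = v ∧ b = t) ∨ (a = t ∧ b = v) := by
  rw [adj_append_append, adj_append A v (B ++ [t])]
  have e : t :: B.reverse = (B ++ [t]).reverse := by simp
  rw [e, adj_reverse]
  have := adj_of_append_right (A := [v]) (B := B ++ [t]) (a := a) (b := b)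
  simp only [List.cons_append, List.nil_append] at this
  tauto

/-- The flip at `v`: if the last point `t` is seen from `v`, one can reverse what follows `v`. -/
theorem reach_flip {A : List V} {v : V} {B : List V} {t : V}
    (hl : X.Plane (A ++ v :: (B ++ [t]))) (hu : X.Unc (Adj (A ++ v :: (B ++ [t]))) v t) :
    X.Reach (A ++ v :: (B ++ [t])) (A ++ v :: t :: B.reverse) :=
  .single ⟨hl, hl.insert hu (adj_flip A v B t), A, v, B ++ [t], rfl, by simp⟩

/-! ### Sight lines from a run of inner points. -/

variable (X) in
/-- No inner point of `T` lies inside a triangle of inner points. -/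
def TwoLayers (T : Finset V) : Prop :=
  ∀ p a b c, X.Inner T p → X.Inner T a → X.Inner T b → X.Inner T c → ¬ X.Tri p a b c

variable (X) in
/-- A set `Obs` of obstacles on `T`, of which those not within `R` do not cross any other; the
obstacles avoiding `R` are the edges `E`. -/
structure Visibility (T R : Finset V) (Obs E : V → V → Prop) : Prop where
  inner : ∀ r ∈ R, X.Inner T r
  two : X.TwoLayers T
  symm_mem : ∀ a b, Obs a b → Obs b a ∧ a ∈ T
  ne : ∀ a b, Obs a b → a ≠ b
  edge : ∀ a b, E a b → Obs a b ∧ a ∉ R ∧ b ∉ R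
  unc : ∀ a b, Obs a b → a ∉ R → X.Unc Obs a b
  out : ∀ a b, Obs a b → a ∉ R → b ∉ R → E a b
  nbr : ∀ a ∈ T, a ∉ R → ∃ b, E a b

variable (X) in
/-- Some point of `R` sees both ends of an edge that is not a hull edge. -/
def Win (T R : Finset V) (Obs E : V → V → Prop) : Prop :=
  ∃ r ∈ R, ∃ a b, E a b ∧ ¬ X.HullEdge T a b ∧ X.Unc Obs r a ∧ X.Unc Obs r b

@[simp] theorem mirror_unc {Obs : V → V → Prop} {a b : V} :
    X.mirror.Unc Obs a b ↔ X.Unc Obs a b := by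
  simp [Unc, Cr]

@[simp] theorem mirror_twoLayers {T : Finset V} : X.mirror.TwoLayers T ↔ X.TwoLayers T := by
  simp [TwoLayers, Tri]

@[simp] theorem mirror_win {T R : Finset V} {Obs E : V → V → Prop} :
    X.mirror.Win T R Obs E ↔ X.Win T R Obs E := by
  simp [Win]

theorem Visibility.mirror {T R : Finset V} {Obs E : V → V → Prop} (h : X.Visibility T R Obs E) :
    X.mirror.Visibility T R Obs E where
  inner := by simpa using h.inner
  two := by simpa using h.two
  symm_mem := h.symm_mem
  ne := h.ne
  edge := h.edge
  unc := by simpa using h.unc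
  out := h.out
  nbr := h.nbr

open Classical in
-- The termination measure when the sight line to `c` turns from `r` to `g`: a point left of `gc`
-- but not of `rc` would put `c` inside `r g p`, and `g` itself is lost. In `card_turn_lt'` the line
-- turns about `r` instead.
theorem card_turn_lt {T : Finset V} (Q : V → Prop) {r c g : V} (hg : g ∈ T) (hQ : Q g)
    (h : X.o r c g = true) (hno : ∀ p ∈ T, Q p → ¬ X.Tri c r g p) :
    (T.filter fun p => Q p ∧ X.o g c p = true).card <
      (T.filter fun p => Q p ∧ X.o r c p = true).card := by
  refine Finset.card_lt_card ?_
  rw [Finset.ssubset_iff_of_subset]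
  · exact ⟨g, by simp [hg, hQ, h], by simp [X.deg₂]⟩
  · intro p
    simp only [Finset.mem_filter, and_imp]
    refine fun hp hQp ho => ⟨hp, hQp, ?_⟩
    have e1 := X.ne_of_o h
    have e2 := X.ne_of_o ho
    have hpr : p ≠ r := by
      rintro rfl
      grind [X.perms e1, X.perms e2]
    rcases X.o_or (a := r) (b := c) (c := p) (by grind) (by grind) (by grind) with h' | h'
    · exact h'
    · exact (hno p hp hQp (tri_of_turn h ho h')).elim

open Classical in
theorem card_turn_lt' {T : Finset V} (Q : V → Prop) {r c g : V} (hg : g ∈ T) (hQ : Q g)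
    (h : X.o r c g = true) (hno : ∀ p ∈ T, Q p → ¬ X.Tri r c g p) :
    (T.filter fun p => Q p ∧ X.o r g p = true).card <
      (T.filter fun p => Q p ∧ X.o r c p = true).card := by
  refine Finset.card_lt_card ?_
  rw [Finset.ssubset_iff_of_subset]
  · exact ⟨g, by simp [hg, hQ, h], by simp [X.deg₁]⟩
  · intro p
    simp only [Finset.mem_filter, and_imp]
    refine fun hp hQp ho => ⟨hp, hQp, ?_⟩
    have e1 := X.ne_of_o h
    have e2 := X.ne_of_o ho
    have hpr : p ≠ c := by
      rintro rfl
      grind [X.perms e1, X.perms e2]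
    rcases X.o_or (a := r) (b := c) (c := p) (by grind) (by grind) (by grind) with h' | h'
    · exact h'
    · exact (hno p hp hQp (tri_of_turn' h ho h')).elim

section visibility

variable {T R : Finset V} {Obs E : V → V → Prop}

open Classical in
-- The sight line `rc` is turned repeatedly towards its left side, about `c` or about `r`. Each turn
-- decreases the number of inner points on its left, since by `TwoLayers` no inner point is inside a
-- triangle of inner points. When no turn remains, `r` sees both ends of an edge at `c`, which is
-- not a hull edge because `c` is inner.
theorem Visibility.win_of_left (H : X.Visibility T R Obs E) {r c d : V} (hr : r ∈ R)
    (hc : X.Inner T c) (hcR : c ∉ R) (hrc : X.Unc Obs r c) (hd : E c d)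
    (hl : X.o r c d = true) : X.Win T R Obs E := by
  induction hN : (T.filter fun p => X.Inner T p ∧ X.o r c p = true).card using
    Nat.strong_induction_on generalizing r c d with
  | _ N ih =>
  subst hN
  have memR : ∀ a b, Obs a b → b ∈ T := fun a b h => (H.symm_mem _ _ (H.symm_mem _ _ h).1).2
  -- Among the obstacles at `c` on the left of `rc`, the one to `y` is angularly closest to the ray
  -- from `c` to `r`, so none points into the angle swept next.
  obtain ⟨y, hy, hfirst⟩ := exists_first (X := X.mirror)
    (A := T.filter fun y => Obs c y ∧ X.o r c y = true) (p := c) (q := r)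
    ⟨d, by simpa [memR _ _ (H.edge _ _ hd).1, (H.edge _ _ hd).1] using hl⟩
    (fun a ha => (Finset.mem_filter.1 ha).2.2)
  simp only [Finset.mem_filter, and_imp, mirror_o] at hy hfirst
  obtain ⟨hyT, hcy, hry⟩ := hy
  have hang : ∀ y', Obs c y' → ¬ (X.o r c y' = true ∧ X.o c y y' = true) := by
    rintro y' h1 ⟨h2, h3⟩
    have := hfirst y' (memR _ _ h1) h1 h2 (X.ne_of_o h3).2.1.symm
    have := o_swap h3
    grind
  by_cases hyR : y ∈ R
  · have hyi := H.inner y hyR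
    refine ih _ (card_turn_lt (X.Inner T) hyi.1 hyi hry fun p _ hp =>
      H.two _ _ _ _ hc (H.inner r hr) hyi hp) hyR hc hcR (H.unc _ _ hcy hcR).symm hd ?_ rfl
    exact hfirst d (memR _ _ (H.edge _ _ hd).1) (H.edge _ _ hd).1 hl
      (fun e => (H.edge _ _ hd).2.2 (e ▸ hyR))
  have hE := H.out _ _ hcy hcR hyR
  rcases sweep H.symm_mem hrc (H.unc _ _ hcy hcR) hry hang with h | ⟨g, hgT, ht, ho, h1, h2, h3⟩
  · exact ⟨r, hr, c, y, hE, fun h => h.not_inner (H.ne _ _ hcy) hc, hrc, h⟩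
  have hgi : X.Inner T g := ⟨hgT, r, (H.inner r hr).1, c, hc.1, y, hyT, ht⟩
  -- The point `g` blocks the view of `y`: in `R` it becomes the new viewpoint, otherwise it becomes
  -- the new target, with its edge lying left of `rg`.
  by_cases hgR : g ∈ R
  · refine ih _ (card_turn_lt (X.Inner T) hgT hgi ho fun p _ hp =>
      H.two _ _ _ _ hc (H.inner r hr) hgi hp) hgR hc hcR h2.symm hE ?_ rfl
    rw [← X.rot]
    exact (ht.left hry).2.1
  · obtain ⟨d', hd'⟩ := H.nbr g hgT hgR
    have he := H.edge _ _ hd'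
    exact ih _ (card_turn_lt' (X.Inner T) hgT hgi ho fun p _ hp =>
      H.two _ _ _ _ (H.inner r hr) hc hgi hp) hr hgi hgR h1 hd'
      (h3 d' he.1 (fun e => he.2.2 (e ▸ hr)) (H.ne _ _ he.1).symm) rfl

theorem Visibility.win_of_inner (H : X.Visibility T R Obs E) {r c : V} (hr : r ∈ R)
    (hc : X.Inner T c) (hcR : c ∉ R) (hrc : X.Unc Obs r c) : X.Win T R Obs E := by
  obtain ⟨d, hd⟩ := H.nbr c hc.1 hcR
  have he := H.edge _ _ hd
  rcases X.o_or (a := r) (b := c) (c := d) (fun e => hcR (e ▸ hr)) (H.ne _ _ he.1)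
    (fun e => he.2.2 (e ▸ hr)) with h | h
  · exact H.win_of_left hr hc hcR hrc hd h
  · have := H.mirror.win_of_left hr (by simpa) hcR (by simpa) hd h
    simpa using this

open Classical in
-- The same turning about a hull point `c`. Here all points left of the sight line are counted, and
-- the count drops because `c` is inside no triangle. A blocking point outside `R` is inner and seen
-- from `r`, so `win_of_inner` applies.
theorem Visibility.next_of_left (H : X.Visibility T R Obs E) {r c d : V} (hr : r ∈ R)
    (hcT : c ∈ T) (hc : ¬ X.Inner T c) (hcR : c ∉ R) (hrc : X.Unc Obs r c) (hd : E c d)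
    (hl : X.o r c d = true) (hE : ∀ y, E c y → y ≠ d → X.HullEdge T c y) :
    X.Win T R Obs E ∨ ∃ r ∈ R, X.Unc Obs r c ∧ X.Unc Obs r d := by
  induction hN : (T.filter fun p => True ∧ X.o r c p = true).card using
    Nat.strong_induction_on generalizing r with
  | _ N ih =>
  subst hN
  have memR : ∀ a b, Obs a b → b ∈ T := fun a b h => (H.symm_mem _ _ (H.symm_mem _ _ h).1).2
  have hcd := H.edge _ _ hd
  by_cases hang : ∀ y, Obs c y → ¬ (X.o r c y = true ∧ X.o c d y = true)
  swap
  · push Not at hang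
    obtain ⟨y, hcy, h1, h2⟩ := hang
    have hyT := memR _ _ hcy
    by_cases hyR : y ∈ R
    · have hlt := card_turn_lt (fun _ => True) hyT trivial h1 fun p hp _ ht =>
        hc ⟨hcT, r, (H.inner r hr).1, y, hyT, p, hp, ht⟩
      refine ih _ (by convert hlt) hyR (H.unc _ _ hcy hcR).symm ?_ rfl
      rw [← X.rot]; exact h2
    -- The edge `cy` is a hull edge, yet its line would separate `r` from `d`.
    · have e1 := X.ne_of_o h1
      have e2 := X.ne_of_o h2
      have := hE y (H.out _ _ hcy hcR hyR) e2.2.1.symm r (H.inner r hr).1 d (memR _ _ hcd.1)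
        (by grind) (by grind) (by grind) (by grind)
      grind [X.perms e1, X.perms e2]
  rcases sweep H.symm_mem hrc (H.unc _ _ hcd.1 hcR) hl hang with h | ⟨g, hgT, ht, ho, h1, h2, h3⟩
  · exact .inr ⟨r, hr, hrc, h⟩
  by_cases hgR : g ∈ R
  · have hlt := card_turn_lt (fun _ => True) hgT trivial ho fun p hp _ ht =>
      hc ⟨hcT, r, (H.inner r hr).1, g, hgT, p, hp, ht⟩
    refine ih _ (by convert hlt) hgR h2.symm ?_ rfl
    rw [← X.rot]
    exact (ht.left hl).2.1
  · exact .inl (H.win_of_inner hr ⟨hgT, r, (H.inner r hr).1, c, hcT, d, memR _ _ hcd.1, ht⟩ hgR h1)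

theorem Visibility.next (H : X.Visibility T R Obs E) {r c d : V} (hr : r ∈ R)
    (hcT : c ∈ T) (hc : ¬ X.Inner T c) (hcR : c ∉ R) (hrc : X.Unc Obs r c) (hd : E c d)
    (hE : ∀ y, E c y → y ≠ d → X.HullEdge T c y) :
    X.Win T R Obs E ∨ ∃ r ∈ R, X.Unc Obs r c ∧ X.Unc Obs r d := by
  have he := H.edge _ _ hd
  rcases X.o_or (a := r) (b := c) (c := d) (fun e => hcR (e ▸ hr)) (H.ne _ _ he.1)
    (fun e => he.2.2 (e ▸ hr)) with h | h
  · exact H.next_of_left hr hcT hc hcR hrc hd h hE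
  · have := H.mirror.next_of_left hr hcT (by simpa) hcR (by simpa) hd h (by simpa using hE)
    simpa using this

/-- The path is traced back from its end, keeping a seen point `c` behind which all edges are hull
edges. An inner `c` wins at once; otherwise either a win occurs or some point of `R` sees both ends
of the edge preceding `c`. The trace stops at the latest at a non-hull edge. -/
theorem Visibility.win_of_path {l : List V} (H : X.Visibility T R Obs (Adj l)) (hl : l.Nodup)
    (hlT : ∀ x ∈ l, x ∈ T) (hlR : ∀ x ∈ l, x ∉ R)
    (hne : ∃ a b, Adj l a b ∧ ¬ X.HullEdge T a b) {A B : List V} {c r : V}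
    (hA : l = A ++ c :: B) (hB : ∀ x y, Nx (c :: B) x y → X.HullEdge T x y) (hr : r ∈ R)
    (hrc : X.Unc Obs r c) : X.Win T R Obs (Adj l) := by
  induction hn : A.length generalizing A B c r with
  | zero =>
    obtain rfl := List.eq_nil_of_length_eq_zero hn
    obtain ⟨a, b, h1, h2⟩ := hne
    subst hA
    exact (h2 (h1.elim (hB a b) fun h => (hB b a h).symm)).elim
  | succ n ih =>
    have hcl : c ∈ l := by simp [hA]
    rcases A.eq_nil_or_concat with rfl | ⟨A, d, rfl⟩
    · simp at hn
    rw [List.concat_eq_append] at hA hn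
    by_cases hc : X.Inner T c
    · exact H.win_of_inner hr hc (hlR _ hcl) hrc
    have hcd : Adj l c d := by
      rw [hA]; rw [hA] at hl; exact (adj_mid hl).2 (.inl ⟨A, rfl⟩)
    have := H.next hr (hlT c hcl) hc (hlR c hcl) hrc hcd (fun y hy hyd => by
      rw [hA] at hl hy
      rcases (adj_mid hl).1 hy with ⟨A', h⟩ | ⟨B', rfl⟩
      · exact (hyd (by simpa using (List.append_inj' h rfl).2.symm)).elim
      · exact hB _ _ (by simp))
    rcases this with h | ⟨r', hr', h1, h2⟩
    · exact h
    by_cases hHE : X.HullEdge T c d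
    · refine ih (A := A) (B := c :: B) (c := d) (r := r') (by simp [hA]) ?_ hr' h2
        (by simpa using hn)
      intro x y hxy
      rw [nx_cons_cons] at hxy
      rcases hxy with ⟨rfl, rfl⟩ | hxy
      · exact hHE.symm
      · exact hB _ _ hxy
    · exact ⟨r', hr', c, d, hcd, hHE, h1, h2⟩

end visibility

/-! ### Plane paths and hull edges. -/

theorem not_cr_self {p q : V} : ¬ X.Cr p q p q := fun h => by have := h.nodup; grind

theorem HullEdge.not_cr {T : Finset V} {x y a b : V} (h : X.HullEdge T x y) (ha : a ∈ T)
    (hb : b ∈ T) : ¬ X.Cr x y a b := by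
  intro hc
  have n := hc.nodup
  have := h a ha b hb (by grind) (by grind) (by grind) (by grind)
  have := X.swap x y a (by grind) (by grind) (by grind)
  have := X.swap x y b (by grind) (by grind) (by grind)
  simp only [Cr, cross] at hc
  grind

theorem plane_append {A : List V} {v : V} {B : List V} (hA : X.Plane (A ++ [v]))
    (hB : X.Plane (v :: B)) (h : ∀ a b c d, Adj (A ++ [v]) a b → Adj (v :: B) c d →
      ¬ X.Cr a b c d) : X.Plane (A ++ v :: B) := by
  intro a b c d h1 h2 hc
  rw [adj_append] at h1 h2
  rcases h1 with h1 | h1 <;> rcases h2 with h2 | h2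
  · exact hA _ _ _ _ h1 h2 hc
  · exact h _ _ _ _ h1 h2 hc
  · exact h _ _ _ _ h2 h1 hc.symm
  · exact hB _ _ _ _ h1 h2 hc

variable (X) in
/-- A plane path through the points of `T`. -/
def Path (T : Finset V) (l : List V) : Prop := l.Nodup ∧ (∀ x, x ∈ l ↔ x ∈ T) ∧ X.Plane l

variable (X) in
/-- The plane paths on `T` starting at `s` are connected by flips. -/
def Connected (T : Finset V) (s : V) : Prop :=
  ∀ m m', X.Path T (s :: m) → X.Path T (s :: m') → X.Reach (s :: m) (s :: m')

theorem Path.of_reach {T : Finset V} {l l' : List V} (h : X.Path T l) (h' : X.Reach l l') :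
    X.Path T l' :=
  ⟨h'.perm.nodup_iff.1 h.1, fun x => by rw [← h.2.1, h'.perm.mem_iff], h'.plane h.2.2⟩

/-- Prepending a point along a hull edge. -/
theorem Path.cons [DecidableEq V] {T : Finset V} {s a : V} {m : List V} (hs : s ∈ T)
    (h : X.Path (T.erase s) (a :: m)) (ha : X.HullEdge T s a) : X.Path T (s :: a :: m) := by
  have hsm : s ∉ a :: m := by rw [h.2.1]; simp
  refine ⟨List.nodup_cons.2 ⟨hsm, h.1⟩, fun x => ?_, ?_⟩
  · rw [List.mem_cons, h.2.1, Finset.mem_erase]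
    grind
  · have hmem : ∀ x y, Adj (a :: m) x y → x ∈ T ∧ y ∈ T := fun x y hxy =>
      ⟨Finset.mem_of_mem_erase ((h.2.1 x).1 hxy.mem.1),
        Finset.mem_of_mem_erase ((h.2.1 y).1 hxy.mem.2)⟩
    exact h.2.2.insert (x := s) (y := a)
      (fun x y hxy hc => ha.not_cr (hmem x y hxy).1 (hmem x y hxy).2 hc.symm)
      fun x y hxy => by rw [adj_cons_cons] at hxy; tauto

/-- The first and the last point in angular order around `p` are hull neighbours; the third point
`z` makes them distinct, so one differs from `t`. -/
theorem exists_hullEdge_ne {T : Finset V} {p t z : V} (hp : p ∈ T) (hi : ¬ X.Inner T p)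
    (ht : t ∈ T) (htp : t ≠ p) (hz : z ∈ T) (hzp : z ≠ p) (hzt : z ≠ t) :
    ∃ a ∈ T, a ≠ p ∧ a ≠ t ∧ X.HullEdge T p a := by
  obtain ⟨a, ha, hap, h⟩ := exists_hull_neighbor hp hi ht htp
  by_cases hat : a = t
  · subst hat
    obtain ⟨b, hb, hbp, h'⟩ := exists_hull_neighbor' hp hi ht htp
    refine ⟨b, hb, hbp, ?_, (hullEdge_of_forall (X := X.mirror) h' |> mirror_hullEdge.1)⟩
    rintro rfl
    have h1 := h z hz hzp hzt
    have h2 := h' z hz hzp hzt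
    have := o_swap h1
    grind
  · exact ⟨a, ha, hap, hat, hullEdge_of_forall h⟩

/-- In convex position: leave `s` along a hull edge that avoids `t`, delete `s` and repeat until
only `t` is left. -/
theorem exists_path_ending {T : Finset V} (hT : ∀ x, ¬ X.Inner T x) {s t : V} (hs : s ∈ T)
    (ht : t ∈ T) (hst : s ≠ t) : ∃ m, X.Path T (s :: (m ++ [t])) := by
  classical
  induction hn : T.card generalizing T s with
  | zero => simp_all
  | succ n ih =>
    by_cases hz : ∃ z ∈ T, z ≠ s ∧ z ≠ t
    · obtain ⟨z, hz, hzs, hzt⟩ := hz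
      obtain ⟨a, ha, has, hat, hHE⟩ := exists_hullEdge_ne hs (hT s) ht hst.symm hz hzs hzt
      obtain ⟨m, hm⟩ := ih (T := T.erase s) (s := a)
        (fun x hx => hT x (hx.mono (Finset.erase_subset _ _))) (by simp [ha, has])
        (by simp [ht, hst.symm]) hat (by rw [Finset.card_erase_of_mem hs]; omega)
      exact ⟨a :: m, hm.cons hs hHE⟩
    · push Not at hz
      refine ⟨[], by simpa using hst, fun x => ?_, ?_⟩
      · simp only [List.nil_append, List.mem_cons, List.not_mem_nil, or_false]
        exact ⟨by rintro (rfl | rfl) <;> assumption, fun hx => by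
          by_cases h : x = s
          · exact .inl h
          · exact .inr (hz x hx h)⟩
      · intro a b c d h1 h2 hc
        have := hc.nodup
        simp only [List.nil_append, adj_cons_cons, adj_singleton, or_false] at h1 h2
        grind

/-! ### Final runs of inner points. -/

section inner

variable {T : Finset V}

/-- A segment crossing no edge of a path of inner points separates no two of them. -/
theorem TwoLayers.not_cr (h2 : X.TwoLayers T) {Q : List V} (hQ : ∀ q ∈ Q, X.Inner T q)
    (hn : Q.Nodup) {x y : V} (hx : x ∈ T) (hy : y ∈ T) (hxQ : x ∉ Q) (hyQ : y ∉ Q)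
    (hu : ∀ a b, Adj Q a b → ¬ X.Cr x y a b) : ∀ p ∈ Q, ∀ q ∈ Q, ¬ X.Cr x y p q := by
  -- A point of `T` inside a triangle of inner points is itself inner. So by `pasch` the segment
  -- `xy` crosses an even number of sides of such a triangle, and non-crossing passes from two sides
  -- to the third.
  have htri : ∀ z ∈ T, ∀ a b c, X.Inner T a → X.Inner T b → X.Inner T c → ¬ X.Tri z a b c :=
    fun z hz a b c ha hb hc ht => h2 z a b c ⟨hz, a, ha.1, b, hb.1, c, hc.1, ht⟩ ha hb hc ht
  induction Q with
  | nil => simp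
  | cons q₀ Q ih =>
    cases Q with
    | nil =>
      simp only [List.mem_singleton, forall_eq]
      intro hc; have := hc.nodup; grind
    | cons q₁ Q =>
      have ih' := ih (fun q hq => hQ q (by simp [hq])) (List.nodup_cons.1 hn).2
        (fun h => hxQ (by simp [h])) (fun h => hyQ (by simp [h]))
        (fun a b hab => hu a b (by simp [hab]))
      have key : ∀ q ∈ q₁ :: Q, ¬ X.Cr x y q₀ q := by
        intro q hq hc
        have n := hc.nodup
        have e1 := hu q₀ q₁ (by simp)
        have e2 := ih' q₁ (by simp) q hq
        by_cases hqq : q = q₁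
        · subst hqq; exact e1 hc
        have i0 := hQ q₀ (by simp)
        have i1 := hQ q₁ (by simp)
        have i2 := hQ q (by simp only [List.mem_cons] at hq ⊢; tauto)
        have hp := pasch (X := X) (x := x) (y := y) (a := q₀) (b := q₁) (c := q) (by
          simp only [List.nodup_cons, List.mem_cons, List.not_mem_nil, not_or] at n hn hxQ hyQ ⊢
          grind)
        have t1 := htri x hx q₀ q₁ q i0 i1 i2
        have t2 := htri y hy q₀ q₁ q i0 i1 i2
        have hc' := hc.swap_right
        simp only [Cr, Tri] at *
        grind
      intro p hp q hq hc
      rw [List.mem_cons] at hp hq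
      rcases hp with rfl | hp <;> rcases hq with rfl | hq
      · have := hc.nodup; grind
      · exact key q hq hc
      · exact key p hp hc.swap_right
      · exact ih' p hp q hq hc

variable {P : List V} {w u r : V} {M M' : List V}

/-- The obstacles for the run `u :: M` after `P ++ [w]`: the edges of `P ++ [w]`, the segments
from `w` to the two ends of the run, and all segments within the run. -/
def RunObs (P : List V) (w u r : V) (M : List V) (a b : V) : Prop :=
  Adj (P ++ [w]) a b ∨ ((a = w ∧ (b = u ∨ b = r)) ∨ (b = w ∧ (a = u ∨ a = r))) ∨
    (a ∈ u :: M ∧ b ∈ u :: M ∧ a ≠ b)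

open Classical in
-- The obstacles include every edge that can occur after any reordering of the run that starts at
-- `u` or `r`; sight lines found here therefore survive the reordering. Segments within the run may
-- cross each other, but by `TwoLayers.not_cr` no other obstacle crosses them.
theorem visibility_run (h2 : X.TwoLayers T) (hl : X.Path T (P ++ w :: u :: M))
    (hP : P ≠ []) (hR : u :: M = M' ++ [r]) (hin : ∀ x ∈ u :: M, X.Inner T x)
    (hwr : X.Unc (Adj (P ++ w :: u :: M)) w r) :
    X.Visibility T (u :: M).toFinset (RunObs P w u r M) (Adj (P ++ [w])) := by
  obtain ⟨hn, hmem, hpl⟩ := hl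
  have hsplit : P ++ w :: u :: M = (P ++ [w]) ++ (u :: M) := by simp
  have hdisj : ∀ x, x ∈ P ++ [w] → x ∉ u :: M := by
    rw [hsplit] at hn
    intro x h1 h2
    exact (List.nodup_append.1 hn).2.2 x h1 x h2 rfl
  have hnR : (u :: M).Nodup := by rw [hsplit] at hn; exact (List.nodup_append.1 hn).2.1
  have hnP : (P ++ [w]).Nodup := by rw [hsplit] at hn; exact (List.nodup_append.1 hn).1
  have hw : w ∉ u :: M := hdisj w (by simp)
  have hrR : r ∈ u :: M := by rw [hR]; simp
  have hT : ∀ x, x ∈ P ++ [w] ∨ x ∈ u :: M → x ∈ T := fun x hx => by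
    rw [← hmem, hsplit, List.mem_append]; exact hx
  have hadjP : ∀ {a b}, Adj (P ++ [w]) a b → Adj (P ++ w :: u :: M) a b := fun h => by
    rw [hsplit]; exact adj_of_append_left h
  have hadjR : ∀ {a b}, Adj (u :: M) a b → Adj (P ++ w :: u :: M) a b := fun h => by
    rw [hsplit]; exact adj_of_append_right h
  have hwu : Adj (P ++ w :: u :: M) w u := by rw [adj_append]; simp
  -- `TwoLayers.not_cr` needs the ends of the segment off the list, so `r` is removed from the run;
  -- a segment with end `r` cannot cross `wr` anyway.
  have hru : ∀ p ∈ u :: M, ∀ q ∈ u :: M, ¬ X.Cr w r p q := by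
    intro p hp q hq hc
    have n := hc.nodup
    rw [hR] at hnR hp hq hw
    simp only [List.nodup_append, List.mem_append, List.mem_singleton, not_or] at hnR hp hq hw
    refine h2.not_cr (Q := M') (fun x hx => hin x (by rw [hR]; simp [hx])) hnR.1
      (hT w (by simp)) (hT r (.inr hrR)) hw.1 (fun h => hnR.2.2 r h r rfl rfl) ?_
      p (by grind) q (by grind) hc
    intro a b hab hc
    exact hwr a b (hadjR (by rw [hR]; exact adj_of_append_left hab)) hc.symm
  have huu : ∀ p ∈ u :: M, ∀ q ∈ u :: M, ¬ X.Cr w u p q := by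
    intro p hp q hq hc
    have n := hc.nodup
    simp only [List.nodup_cons, List.mem_cons, not_or] at hnR hp hq hw
    refine h2.not_cr (Q := M) (fun x hx => hin x (by simp [hx])) hnR.2
      (hT w (by simp)) (hT u (by simp)) hw.2 hnR.1 ?_
      p (by grind) q (by grind) hc
    intro a b hab hc
    exact hpl _ _ _ _ hwu (hadjR (adj_of_append_right (A := [u]) hab)) hc
  have hpp : ∀ a b, Adj (P ++ [w]) a b → ∀ p ∈ u :: M, ∀ q ∈ u :: M, ¬ X.Cr a b p q := by
    intro a b hab
    refine h2.not_cr hin hnR (hT a (.inl hab.mem.1)) (hT b (.inl hab.mem.2))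
      (hdisj a hab.mem.1) (hdisj b hab.mem.2) ?_
    intro c d hcd hc
    exact hpl _ _ _ _ (hadjP hab) (hadjR hcd) hc
  have hwrS : ∀ a b, Adj (P ++ w :: u :: M) a b → ¬ X.Cr w r a b := fun a b h hc =>
    hwr a b h hc.symm
  have main : ∀ a b c d, (Adj (P ++ [w]) a b ∨ (a = w ∧ (b = u ∨ b = r))) →
      (Adj (P ++ [w]) c d ∨ (c = w ∧ (d = u ∨ d = r)) ∨ (c ∈ u :: M ∧ d ∈ u :: M)) →
      ¬ X.Cr a b c d := by
    rintro a b c d (h1 | ⟨rfl, rfl | rfl⟩) (h3 | ⟨rfl, rfl | rfl⟩ | h3)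
    · exact hpl _ _ _ _ (hadjP h1) (hadjP h3)
    · exact hpl _ _ _ _ (hadjP h1) hwu
    · exact hwr _ _ (hadjP h1)
    · exact hpp a b h1 c h3.1 d h3.2
    · exact hpl _ _ _ _ hwu (hadjP h3)
    · exact not_cr_self
    · exact hwr _ _ hwu
    · exact huu c h3.1 d h3.2
    · exact hwrS _ _ (hadjP h3)
    · exact hwrS _ _ hwu
    · exact not_cr_self
    · exact hru c h3.1 d h3.2
  refine ⟨fun x hx => hin x (by simpa using hx), h2, ?_, ?_, ?_, ?_, ?_, ?_⟩
  · intro a b hab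
    refine ⟨?_, ?_⟩
    · rcases hab with h | h | h
      · exact .inl h.symm
      · exact .inr (.inl h.symm)
      · exact .inr (.inr ⟨h.2.1, h.1, h.2.2.symm⟩)
    · rcases hab with h | (⟨rfl, _⟩ | h) | h
      · exact hT _ (.inl h.mem.1)
      · exact hT _ (by simp)
      · rcases h.2 with rfl | rfl
        · exact hT _ (by simp)
        · exact hT _ (.inr hrR)
      · exact hT _ (.inr h.1)
  · intro a b hab
    rcases hab with h | (⟨rfl, rfl | rfl⟩ | ⟨rfl, rfl | rfl⟩) | h
    · exact h.ne hnP
    all_goals grind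
  · intro a b hab
    simp only [List.mem_toFinset]
    exact ⟨.inl hab, hdisj _ hab.mem.1, hdisj _ hab.mem.2⟩
  · intro a b hab haR c d hcd hc
    rw [List.mem_toFinset] at haR
    have h1 : Adj (P ++ [w]) a b ∨ (a = w ∧ (b = u ∨ b = r)) := by
      rcases hab with h | (h | ⟨-, h⟩) | h
      · exact .inl h
      · exact .inr h
      · rcases h with rfl | rfl
        · simp at haR
        · exact (haR hrR).elim
      · exact (haR h.1).elim
    rcases hcd with h | (h | h) | h
    · exact main _ _ _ _ h1 (.inl h) hc.symm
    · exact main _ _ _ _ h1 (.inr (.inl h)) hc.symm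
    · exact main _ _ d c h1 (.inr (.inl h)) hc.symm.swap_right
    · exact main _ _ _ _ h1 (.inr (.inr ⟨h.1, h.2.1⟩)) hc.symm
  · intro a b hab ha hb
    simp only [List.mem_toFinset] at ha hb
    rcases hab with h | (⟨-, rfl | rfl⟩ | ⟨-, rfl | rfl⟩) | h
    · exact h
    · simp at hb
    · exact (hb hrR).elim
    · simp at ha
    · exact (ha hrR).elim
    · exact (ha h.1).elim
  · intro a haT ha
    rw [List.mem_toFinset] at ha
    rw [← hmem, hsplit, List.mem_append] at haT
    refine exists_adj (haT.resolve_right ha) ?_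
    have := List.length_pos_of_ne_nil hP
    simp only [List.length_append, List.length_singleton]
    omega


open Classical in
theorem win_run (h2 : X.TwoLayers T) (hl : X.Path T (P ++ w :: u :: M))
    (hR : u :: M = M' ++ [r]) (hin : ∀ x ∈ u :: M, X.Inner T x)
    (hne : ∃ a b, Adj (P ++ [w]) a b ∧ ¬ X.HullEdge T a b)
    (hwr : X.Unc (Adj (P ++ w :: u :: M)) w r) :
    X.Win T (u :: M).toFinset (RunObs P w u r M) (Adj (P ++ [w])) := by
  have hP : P ≠ [] := by
    rintro rfl
    simp at hne
  have H := visibility_run h2 hl hP hR hin hwr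
  obtain ⟨hn, hmem, hpl⟩ := hl
  have hsplit : P ++ w :: u :: M = (P ++ [w]) ++ (u :: M) := by simp
  rw [hsplit] at hn hmem
  have hdisj : ∀ x ∈ P ++ [w], x ∉ (u :: M).toFinset := fun x h1 h2 =>
    (List.nodup_append.1 hn).2.2 x h1 x (List.mem_toFinset.1 h2) rfl
  refine H.win_of_path (List.nodup_append.1 hn).1 (fun x hx => ?_) hdisj hne
    (A := P) (c := w) (B := []) (r := u) rfl (by simp) (by simp) ?_
  · rw [← hmem, List.mem_append]; exact .inl hx
  · exact (H.unc w u (.inr (.inl (.inl ⟨rfl, .inl rfl⟩))) (hdisj w (by simp))).symm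

/-- When `w` sees both ends of the run, the run may start at either of them; this allows any point
of the run, even `u`, to be brought to the end. -/
theorem exists_last_sees_of_unc (h2 : X.TwoLayers T)
    (hmain : ∀ U : Finset V, (∀ x ∈ U, X.Inner T x) → ∀ u ∈ U, X.Connected U u)
    (hl : X.Path T (P ++ w :: u :: M)) (hin : ∀ x ∈ u :: M, X.Inner T x)
    (hne : ∃ a b, Adj (P ++ [w]) a b ∧ ¬ X.HullEdge T a b) (hR : u :: M = M' ++ [r])
    (hwr : X.Unc (Adj (P ++ w :: u :: M)) w r) :
    ∃ R r, X.Reach (P ++ w :: u :: M) (P ++ w :: (R ++ [r])) ∧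
      ∃ a b, Adj (P ++ [w]) a b ∧ ¬ X.HullEdge T a b ∧
        X.Unc (Adj (P ++ w :: (R ++ [r]))) r a ∧ X.Unc (Adj (P ++ w :: (R ++ [r]))) r b := by
  classical
  have hP : P ≠ [] := by
    rintro rfl
    simp at hne
  have H := visibility_run h2 hl hP hR hin hwr
  obtain ⟨r', hr', a, b, hab, hHE, ha, hb⟩ := win_run h2 hl hR hin hne hwr
  have hsub : ∀ l l' : List V, (∀ c d, Adj l' c d → RunObs P w u r M c d) → l = l' →
      X.Unc (Adj l) r' a ∧ X.Unc (Adj l) r' b := by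
    rintro l _ h rfl
    exact ⟨fun c d hcd => ha c d (h c d hcd), fun c d hcd => hb c d (h c d hcd)⟩
  have hnR : (u :: M).Nodup := by
    have := hl.1
    rw [show P ++ w :: u :: M = (P ++ [w]) ++ (u :: M) by simp] at this
    exact (List.nodup_append.1 this).2.1
  have hw : w ∉ u :: M := by
    have := hl.1
    simp only [List.nodup_append, List.nodup_cons] at this
    exact this.2.1.1
  have hobs : ∀ m y, y = u ∨ y = r → (y :: m).Perm (u :: M) → ∀ c d,
      Adj (P ++ w :: y :: m) c d → RunObs P w u r M c d := by
    intro m y hy hm c d hcd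
    rw [adj_append_append] at hcd
    rcases hcd with h | ⟨rfl, rfl⟩ | ⟨rfl, rfl⟩ | h
    · exact .inl h
    · exact .inr (.inl (.inl ⟨rfl, hy⟩))
    · exact .inr (.inl (.inr ⟨rfl, hy⟩))
    · exact .inr (.inr ⟨hm.mem_iff.1 h.mem.1, hm.mem_iff.1 h.mem.2,
        h.ne (hm.symm.nodup hnR)⟩)
  rw [List.mem_toFinset] at hr'
  by_cases hru : r' = u
  -- The winning point is the first of the run: reversing the run behind `w` makes it the last.
  · subst hru
    rcases M.eq_nil_or_concat with rfl | ⟨M'', v, rfl⟩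
    · exact ⟨[], r', .refl, a, b, hab, hHE, hsub _ _ (hobs [] _ (.inl rfl) (.refl _)) rfl⟩
    · rw [List.concat_eq_append] at *
      have hv : v = r := by
        rw [← List.cons_append] at hR
        simpa using (List.append_inj' hR rfl).2
      subst hv
      have hflip := reach_flip (X := X) (A := P) (v := w) (B := r' :: M'') (t := v) hl.2.2 hwr
      refine ⟨v :: M''.reverse, r', by simpa using hflip, a, b, hab, hHE, ?_⟩
      refine hsub _ _ (hobs ((r' :: M'').reverse) v (.inr rfl) ?_) (by simp)
      exact (List.reverse_perm (r' :: (M'' ++ [v]))).symm.trans (by simp) |>.symm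
  -- The run is in convex position, so some plane path on it leads from `u` to `r'`, and `hmain`
  -- reaches it by flips.
  · have hUin : ∀ x ∈ (u :: M).toFinset, X.Inner T x := fun x hx => hin x (by simpa using hx)
    have hUno : ∀ x, ¬ X.Inner (u :: M).toFinset x := fun x ⟨hx, p, hp, q, hq, z, hz, ht⟩ =>
      h2 _ _ _ _ (hUin x hx) (hUin p hp) (hUin q hq) (hUin z hz) ht
    obtain ⟨m, hm⟩ := exists_path_ending hUno (s := u) (t := r') (by simp) (by simpa using hr')
      (Ne.symm hru)
    have hUpath : X.Path (u :: M).toFinset (u :: M) :=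
      ⟨hnR, fun x => by simp, hl.2.2.mono fun c d h => by
        rw [adj_append_append]; exact .inr (.inr (.inr h))⟩
    have hreach := hmain _ hUin u (by simp) _ _ hUpath hm
    have hlift : X.Reach ((P ++ [w]) ++ u :: M) ((P ++ [w]) ++ u :: (m ++ [r'])) := by
      refine hreach.lift hUpath.2.2 fun C hC hCp => plane_append ?_ hCp ?_
      · refine hl.2.2.mono fun c d h => ?_
        rw [show P ++ w :: u :: M = (P ++ [w] ++ [u]) ++ M by simp]
        exact adj_of_append_left h
      · intro c d e f hcd hef hc
        rw [List.append_assoc, List.singleton_append, adj_append_append] at hcd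
        have hef' : RunObs P w u r M e f := .inr (.inr ⟨hC.mem_iff.1 hef.mem.1,
          hC.mem_iff.1 hef.mem.2, hef.ne (hC.symm.nodup hnR)⟩)
        have hwunc := H.unc w u (.inr (.inl (.inl ⟨rfl, .inl rfl⟩))) (by simpa using hw) _ _ hef'
        simp only [adj_singleton, or_false] at hcd
        rcases hcd with h | ⟨rfl, rfl⟩ | ⟨rfl, rfl⟩
        · exact H.unc c d (.inl h) (H.edge _ _ h).2.1 _ _ hef' hc.symm
        · exact hwunc hc.symm
        · exact hwunc hc.symm.swap_right
    refine ⟨u :: m, r', by simpa using hlift, a, b, hab, hHE, ?_⟩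
    exact hsub _ _ (hobs (m ++ [r']) u (.inl rfl) (hreach.perm.symm)) rfl

/-- One can flip within a final run of inner points so that its last point sees both ends of an
edge, not on the hull, of the initial part of the path. -/
theorem exists_last_sees (h2 : X.TwoLayers T)
    (hmain : ∀ U : Finset V, (∀ x ∈ U, X.Inner T x) → ∀ u ∈ U, X.Connected U u)
    (hl : X.Path T (P ++ w :: u :: M)) (hin : ∀ x ∈ u :: M, X.Inner T x)
    (hne : ∃ a b, Adj (P ++ [w]) a b ∧ ¬ X.HullEdge T a b) :
    ∃ R r, X.Reach (P ++ w :: u :: M) (P ++ w :: (R ++ [r])) ∧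
      ∃ a b, Adj (P ++ [w]) a b ∧ ¬ X.HullEdge T a b ∧
        X.Unc (Adj (P ++ w :: (R ++ [r]))) r a ∧ X.Unc (Adj (P ++ w :: (R ++ [r]))) r b := by
  -- The first point `u` of the run is moved to the initial part. The edge then found either lies in
  -- the old initial part, or is `wu`; in the latter case the last point sees `w`, and
  -- `exists_last_sees_of_unc` applies.
  induction M generalizing P w u with
  | nil =>
    exact exists_last_sees_of_unc (M' := []) h2 hmain hl hin hne rfl
      fun a b h1 h2 => hl.2.2 _ _ _ _ h1 (by rw [adj_append]; simp) h2
  | cons u' M ih =>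
    have e : ∀ L : List V, P ++ w :: L = (P ++ [w]) ++ L := by simp
    have hPw : ∀ {a b}, Adj (P ++ [w]) a b → Adj (P ++ [w] ++ [u]) a b := adj_of_append_left
    obtain ⟨R, r, h1, a, b, hab, hHE, ha, hb⟩ := ih (P := P ++ [w]) (w := u) (u := u')
      (by rwa [e] at hl) (fun x hx => hin x (List.mem_cons_of_mem _ hx))
      (by
        obtain ⟨a, b, h, h'⟩ := hne
        exact ⟨a, b, hPw h, h'⟩)
    rw [← e, ← e] at h1
    rw [← e] at ha hb
    have key : X.Unc (Adj (P ++ w :: u :: (R ++ [r]))) w r →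
        ∃ R r, X.Reach (P ++ w :: u :: u' :: M) (P ++ w :: (R ++ [r])) ∧
        ∃ a b, Adj (P ++ [w]) a b ∧ ¬ X.HullEdge T a b ∧
        X.Unc (Adj (P ++ w :: (R ++ [r]))) r a ∧ X.Unc (Adj (P ++ w :: (R ++ [r]))) r b := by
      intro hwr
      have hp : (u' :: M).Perm (R ++ [r]) := by
        have := h1.perm
        rw [List.perm_append_left_iff, List.perm_cons, List.perm_cons] at this
        exact this
      obtain ⟨R', r', h3, h4⟩ := exists_last_sees_of_unc (M' := u :: R) h2 hmain
        (hl.of_reach h1) (fun x hx => hin x (by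
          rw [List.mem_cons] at hx ⊢; rwa [hp.mem_iff])) hne rfl hwr
      exact ⟨R', r', h1.trans h3, h4⟩
    rw [List.append_assoc, List.singleton_append, adj_append_append] at hab
    simp only [adj_singleton, or_false] at hab
    rcases hab with h | ⟨rfl, rfl⟩ | ⟨rfl, rfl⟩
    · exact ⟨u :: R, r, h1, a, b, h, hHE, ha, hb⟩
    · exact key ha.symm
    · exact key hb.symm

end inner

variable {T : Finset V}

/-! ### Parity of crossings. -/

section parity

/-- The parity of the number of consecutive pairs satisfying `f`. -/
def par (f : V → V → Bool) : List V → Bool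
  | x :: y :: l => f x y ^^ par f (y :: l)
  | _ => false

theorem par_telescope {f f' : V → V → Bool} {g : V → Bool} {l : List V} {t : V} :
    ∀ {d : V}, (∀ x y, Nx (d :: (l ++ [t])) x y → (f x y ^^ f' x y ^^ g x ^^ g y) = false) →
      (par f (d :: (l ++ [t])) ^^ par f' (d :: (l ++ [t])) ^^ g d ^^ g t) = false := by
  induction l with
  | nil =>
    intro d h
    have := h d t (by simp)
    simpa [par] using this
  | cons e l ih =>
    intro d h
    have h1 := h d e (by simp)
    have h2 := ih (d := e) (fun x y hxy => h x y (by
      rw [List.cons_append, nx_cons_cons]; exact .inr hxy))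
    simp only [par, List.cons_append]
    revert h1 h2
    generalize par f (e :: (l ++ [t])) = p, par f' (e :: (l ++ [t])) = p', f d e = q, f' d e = q',
      g d = r₁, g e = r₂, g t = r₃
    revert p p' q q' r₁ r₂ r₃
    decide

theorem par_eq_false {f : V → V → Bool} {l : List V} (h : ∀ x y, Nx l x y → f x y = false) :
    par f l = false := by
  induction l with
  | nil => rfl
  | cons x l ih =>
    cases l with
    | nil => rfl
    | cons y l =>
      rw [par, h x y (by simp), ih fun a b hab => h a b (by simp [hab])]
      rfl

/-- If `x` and `y` are on different sides of the line `bs` but `xy` misses the segment `bs`, then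
one of `b` and `s` is inside the triangle of the other with `x` and `y`. -/
theorem cross_of_separated {b s x y : V} (hn : [b, s, x, y].Nodup) (h1 : ¬ X.Tri b s x y)
    (h2 : ¬ X.Tri s b x y) : (cross X.o x y b s ^^ X.o b s x ^^ X.o b s y) = false :=
  of_decide_eq_true (X.four hn (fun o => decide (¬ tri o 0 1 2 3 = true → ¬ tri o 1 0 2 3 = true →
    (cross o 2 3 0 1 ^^ o 0 1 2 ^^ o 0 1 3) = false)) (by decide +kernel)) h1 h2

/-- A plane path from a hull point cannot separate the two hull neighbours of one of its points. -/
theorem not_hullEdge_next {A C : List V} {s b d t : V} (hl : X.Path T (s :: A ++ b :: d :: (C ++ [t])))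
    (hs : ¬ X.Inner T s) (hbt : X.HullEdge T b t) : ¬ X.HullEdge T b d := by
  intro hbd
  obtain ⟨hn, hmem, hpl⟩ := hl
  have hT : ∀ x, x ∈ s :: A ++ b :: d :: (C ++ [t]) → x ∈ T := fun x => (hmem x).1
  set B := d :: (C ++ [t]) with hB
  have hn' := hn
  rw [List.nodup_append, List.nodup_cons (a := b)] at hn'
  obtain ⟨hnA, ⟨hbB, hnB⟩, hdis⟩ := hn'
  have hbT : b ∈ T := hT b (by simp)
  have hdB : d ∈ B := by simp [hB]
  have htB : t ∈ B := by simp [hB]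
  have hbd' : b ≠ d := fun h => hbB (h ▸ hdB)
  have hbt' : b ≠ t := fun h => hbB (h ▸ htB)
  have hBT : ∀ x ∈ B, x ∈ T := fun x hx => hT x (by simp [hx])
  have hBadj : ∀ {x y}, Nx B x y → Adj (s :: A ++ b :: B) x y := fun h => by
    have := adj_of_append_right (A := s :: A ++ [b]) (B := B) (.inl h)
    simpa using this
  have hne : ∀ {x y}, Nx B x y → x ≠ y := fun h => Adj.ne hnB (.inl h)
  have hAB : ∀ x ∈ s :: A, ∀ y ∈ B, x ≠ y := fun x hx y hy => hdis x hx y (by simp [hy])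
  have hAb : ∀ x ∈ s :: A, x ≠ b := fun x hx => hdis x hx b (by simp)
  have hAT : ∀ x ∈ s :: A, x ∈ T := fun x hx => hT x (by
    rw [List.mem_append]; exact .inl hx)
  -- The parity of the crossings of `bp` with the path `B` is followed as `p` moves back from the
  -- predecessor of `b` to `s`. For consecutive `p` and `q`, `pasch` and telescoping leave only the
  -- question whether `d` or `t` is inside `b p q`, and neither is, being a hull point.
  have key : ∀ D C' p, s :: A = C' ++ p :: D → par (fun x y => cross X.o x y b p) B = false := by
    intro D
    induction D with
    | nil =>
      intro C' p h
      refine par_eq_false fun x y hxy => ?_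
      have := hpl x y b p (hBadj hxy) (by
        rw [h, List.append_assoc, List.singleton_append, adj_append_append]; simp)
      simpa [Cr] using this
    | cons q D ih =>
      intro C' p h
      have hq := ih (C' ++ [p]) q (by rw [h]; simp)
      have hpA : p ∈ s :: A := by rw [h]; simp
      have hqA : q ∈ s :: A := by rw [h]; simp
      have hpq : p ≠ q := by
        rw [h] at hnA
        have := (List.nodup_append.1 hnA).2.1
        grind
      have := par_telescope (f := fun x y => cross X.o x y b p)
        (f' := fun x y => cross X.o x y b q) (g := fun x => tri X.o x b p q) (l := C) (d := d)
        (t := t) (fun x y hxy => by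
          have hm := hxy.mem
          have n1 := hne hxy
          have n2 := hAB p hpA x hm.1
          have n3 := hAB p hpA y hm.2
          have n4 := hAB q hqA x hm.1
          have n5 := hAB q hqA y hm.2
          have n6 := hAb p hpA
          have n7 := hAb q hqA
          have n8 : b ≠ x := fun h => hbB (h ▸ hm.1)
          have n9 : b ≠ y := fun h => hbB (h ▸ hm.2)
          have h1 := pasch (X := X) (x := x) (y := y) (a := b) (b := p) (c := q)
            (by clear * - n1 n2 n3 n4 n5 n6 n7 n8 n9 hpq; grind)
          have h2 := hpl x y p q (hBadj hxy) (by
            rw [h, List.append_assoc, List.cons_append, List.cons_append, adj_append_append]; simp)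
          have h3 := cross_swap_right X.o x y b q
          simp only [Cr] at h2
          clear * - h1 h2 h3
          grind)
      have h1 : tri X.o d b p q = false := by
        by_contra h
        exact hbd.not_inner_right hbd' ⟨hBT d hdB, b, hbT, p, hAT p hpA, q, hAT q hqA, by simpa using h⟩
      have h2 : tri X.o t b p q = false := by
        by_contra h
        exact hbt.not_inner_right hbt' ⟨hBT t htB, b, hbT, p, hAT p hpA, q, hAT q hqA, by simpa using h⟩
      rw [← hB] at this
      simp only [hq, h1, h2] at this
      simpa using this
  have h0 := key A [] s rfl
  have hsA : s ∈ s :: A := by simp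
  have hsb := hAb s hsA
  have hsT := hAT s hsA
  -- As `b` and `s` are hull points, an edge of `B` crosses `bs` exactly when it changes sides of
  -- the line `bs`; even parity puts `d` and `t` on the same side.
  have := par_telescope (f := fun x y => cross X.o x y b s) (f' := fun _ _ => false)
    (g := fun x => X.o b s x) (l := C) (d := d) (t := t) (fun x y hxy => by
      have hm := hxy.mem
      have n1 := hne hxy
      have n2 := hAB s hsA x hm.1
      have n3 := hAB s hsA y hm.2
      have n8 : b ≠ x := fun h => hbB (h ▸ hm.1)
      have n9 : b ≠ y := fun h => hbB (h ▸ hm.2)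
      have := cross_of_separated (X := X) (b := b) (s := s) (x := x) (y := y)
        (by clear * - n1 n2 n3 n8 n9 hsb; grind)
        (fun h => hbd.not_inner hbd' ⟨hbT, s, hsT, x, hBT x hm.1, y, hBT y hm.2, h⟩)
        (fun h => hs ⟨hsT, b, hbT, x, hBT x hm.1, y, hBT y hm.2, h⟩)
      simpa using this)
  rw [← hB, h0, par_eq_false (l := B) fun _ _ _ => rfl] at this
  have hdt : d ≠ t := by
    rw [hB] at hnB
    have := (List.nodup_cons.1 hnB).1
    grind
  have hds := hAB s hsA d hdB
  have hts := hAB s hsA t htB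
  -- As `bd` and `bt` are both hull edges, `s` lies angularly between `d` and `t` around `b`, which
  -- puts these on different sides.
  have e1 := hbd t (hBT t htB) s hsT (by grind) (by grind) (by grind) (by grind)
  have e2 := hbt d (hBT d hdB) s hsT (by grind) (by grind) (by grind) (by grind)
  have p1 := X.perms (a := b) (b := d) (c := t) (by grind)
  have p2 := X.perms (a := b) (b := d) (c := s) (by grind)
  have p3 := X.perms (a := b) (b := t) (c := s) (by grind)
  grind

end parity

/-! ### Reaching a hull edge at the start. -/

/-- The path can be flipped to one whose first edge is a hull edge. -/
def Good (X : CCSystem V) (T : Finset V) (s : V) (l : List V) : Prop :=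
  ∃ v m, X.Reach l (s :: v :: m) ∧ X.HullEdge T s v

theorem Good.of_reach {s : V} {l l' : List V} (h : Good X T s l') (h' : X.Reach l l') :
    Good X T s l := by
  obtain ⟨v, m, h1, h2⟩ := h
  exact ⟨v, m, h'.trans h1, h2⟩

/-- Flip at a hull neighbour `b ≠ c` of the last point `t`. If `b` is the start, the new first edge
is the hull edge; otherwise the edge lost is no hull edge by `not_hullEdge_next`. -/
theorem good_or_increase {s c t : V} {m L : List V} (hL : L = s :: m) (hL' : ∃ A, L = A ++ [c, t])
    (hs : ¬ X.Inner T s) (hl : X.Path T L) (ht : ¬ X.Inner T t) :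
    Good X T s L ∨ ∃ l', X.Reach L l' ∧ cnt (X.HullEdge T) L < cnt (X.HullEdge T) l' := by
  obtain ⟨A, hA⟩ := hL'
  rcases A with _ | ⟨s', A⟩
  · left
    have : c = s := by rw [hA] at hL; exact (List.cons.inj hL).1
    subst this
    refine ⟨t, [], by rw [hA]; exact .refl, fun z hz w hw h1 h2 h3 h4 => ?_⟩
    rw [← hl.2.1, hA] at hz
    simp at hz; tauto
  have hs' : s' = s := by rw [hA] at hL; exact (List.cons.inj hL).1
  subst hs'
  clear hL
  subst hA
  obtain ⟨hn, hmem, hpl⟩ := hl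
  have hn' := hn
  simp only [List.nodup_append, List.nodup_cons, List.mem_cons, List.cons_append, List.mem_append]
    at hn'
  have hmT : ∀ x, x ∈ s' :: A ++ [c, t] → x ∈ T := fun x => (hmem x).1
  have htT : t ∈ T := hmT t (by simp)
  obtain ⟨b, hb, hbt, hbc, hHE⟩ := exists_hullEdge_ne htT ht (hmT c (by simp)) (by grind)
    (hmT s' (by simp)) (by grind) (by grind)
  rw [← hmem] at hb
  have hbA : b ∈ s' :: A := by
    simp only [List.mem_append, List.mem_cons, List.not_mem_nil] at hb ⊢; tauto
  obtain ⟨A1, A2, hA12⟩ := List.append_of_mem hbA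
  have hflip := reach_flip (X := X) (A := A1) (v := b) (B := A2 ++ [c]) (t := t)
    (by rw [hA12] at hpl; simpa using hpl) (fun x y hxy hc => by
      have hxy' : Adj (s' :: A ++ [c, t]) x y := by rw [hA12]; simpa using hxy
      exact hHE.symm.not_cr (hmT x hxy'.mem.1) (hmT y hxy'.mem.2) hc.symm)
  have e1 : A1 ++ b :: (A2 ++ [c] ++ [t]) = s' :: A ++ [c, t] := by rw [hA12]; simp
  rw [e1] at hflip
  rcases A1 with _ | ⟨s'', A1⟩
  · left
    have : b = s' := by rw [List.nil_append] at hA12; exact (List.cons.inj hA12).1.symm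
    subst this
    exact ⟨t, _, hflip, hHE.symm⟩
  right
  have hs'' : s' = s'' := by exact (List.cons.inj hA12).1
  subst hs''
  refine ⟨_, hflip, ?_⟩
  obtain ⟨d, A3, hd⟩ : ∃ d A3, A2 ++ [c] = d :: A3 := by
    rcases A2 with _ | ⟨d, A2⟩
    · exact ⟨c, [], rfl⟩
    · exact ⟨d, A2 ++ [c], rfl⟩
  have hJ : ¬ X.HullEdge T b d := by
    refine not_hullEdge_next (A := A1) (C := A3) (t := t) (s := s') ?_ hs hHE.symm
    have : s' :: A1 ++ b :: d :: (A3 ++ [t]) = s' :: A ++ [c, t] := by rw [← e1, hd]; rfl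
    rw [this]; exact ⟨hn, hmem, hpl⟩
  have h1 := cnt_append (X.HullEdge T) (s' :: A1) b (d :: A3 ++ [t])
  have h2 := cnt_append (X.HullEdge T) (s' :: A1) b (t :: (d :: A3).reverse)
  have h3 := cnt_reverse (X.HullEdge T) (fun _ _ h => h.symm) (d :: A3 ++ [t])
  have h4 := cnt_cons_cons (X.HullEdge T) b d (A3 ++ [t])
  rw [cnt_cons_cons, if_pos hHE.symm] at h2
  rw [if_neg hJ, ← List.cons_append] at h4
  rw [List.reverse_append, List.reverse_singleton, List.singleton_append] at h3
  rw [← e1, hd]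
  omega

theorem not_hullEdge_of_inner {x y : V} (h : X.Inner T y) (hxy : x ≠ y) :
    ¬ X.HullEdge T x y := fun h' => h'.not_inner_right hxy h

/-- Inserting the last point of a path between the two ends of an edge, both of which it sees. -/
theorem reach_insert {A B : List V} {a b r : V} (hl : X.Path T (A ++ a :: b :: (B ++ [r])))
    (ha : X.Unc (Adj (A ++ a :: b :: (B ++ [r]))) r a)
    (hb : X.Unc (Adj (A ++ a :: b :: (B ++ [r]))) r b) (hr : X.Inner T r)
    (hab : ¬ X.HullEdge T a b) :
    X.Reach (A ++ a :: b :: (B ++ [r])) (A ++ a :: r :: b :: B) ∧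
      cnt (X.HullEdge T) (A ++ a :: r :: b :: B) =
        cnt (X.HullEdge T) (A ++ a :: b :: (B ++ [r])) := by
  have hn := hl.1
  simp only [List.nodup_append, List.nodup_cons, List.mem_cons, List.mem_append] at hn
  constructor
  -- The flip at `a` puts `r` behind `a` but reverses the rest; a second flip at `r` restores its
  -- order.
  · have h1 := reach_flip (X := X) (A := A) (v := a) (B := b :: B) (t := r) hl.2.2 ha.symm
    have e1 : A ++ a :: r :: (b :: B).reverse = (A ++ [a]) ++ r :: (B.reverse ++ [b]) := by simp
    have h2 := reach_flip (X := X) (A := A ++ [a]) (v := r) (B := B.reverse) (t := b)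
      (e1 ▸ h1.plane hl.2.2) (fun x y hxy hc => by
        rw [← e1] at hxy
        rcases adj_flip A a (b :: B) r x y hxy with h | ⟨rfl, rfl⟩ | ⟨rfl, rfl⟩
        · exact hb x y h hc
        · have := hc.nodup; grind
        · have := hc.nodup; grind)
    rw [← e1] at h2
    exact h1.trans (by simpa using h2)
  · have f1 : ¬ X.HullEdge T a r := not_hullEdge_of_inner hr (by grind)
    have f2 : ¬ X.HullEdge T r b := fun h => not_hullEdge_of_inner hr (by grind) h.symm
    have f3 : cnt (X.HullEdge T) (b :: (B ++ [r])) = cnt (X.HullEdge T) (b :: B) := by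
      obtain ⟨B', y, hy⟩ : ∃ B' y, b :: B = B' ++ [y] := by
        rcases (b :: B).eq_nil_or_concat with h | ⟨B', y, h⟩
        · simp at h
        · exact ⟨B', y, by rw [h]; simp⟩
      rw [← List.cons_append, hy, List.append_assoc, List.singleton_append, cnt_append,
        cnt_cons_cons, if_neg, cnt_singleton]
      · simp
      · refine not_hullEdge_of_inner hr ?_
        have : y ∈ b :: B := by rw [hy]; simp
        rw [List.mem_cons] at this
        grind
    rw [cnt_append _ A a (r :: b :: B), cnt_append _ A a (b :: (B ++ [r])), cnt_cons_cons,
      cnt_cons_cons, cnt_cons_cons, if_neg f1, if_neg f2, if_neg hab, f3]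
    simp

theorem exists_run {P : V → Prop} {l : List V} (h : ∃ x ∈ l, ¬ P x) :
    ∃ A w R, l = A ++ w :: R ∧ ¬ P w ∧ ∀ x ∈ R, P x := by
  induction l with
  | nil => simp at h
  | cons y l ih =>
    by_cases h' : ∃ x ∈ l, ¬ P x
    · obtain ⟨A, w, R, rfl, hw, hR⟩ := ih h'
      exact ⟨y :: A, w, R, rfl, hw, hR⟩
    · push Not at h'
      obtain ⟨x, hx, hPx⟩ := h
      rw [List.mem_cons] at hx
      rcases hx with rfl | hx
      · exact ⟨[], x, l, rfl, hPx, h'⟩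
      · exact (hPx (h' x hx)).elim

/-- From every plane path one reaches a path whose first edge is a hull edge. -/
theorem exists_good (h2 : X.TwoLayers T) {s : V} (hs : ¬ X.Inner T s)
    (hmain : ∀ U : Finset V, (∀ x ∈ U, X.Inner T x) → ∀ u ∈ U, X.Connected U u)
    {v : V} {m : List V} (hl : X.Path T (s :: v :: m)) : Good X T s (s :: v :: m) := by
  -- The outer induction is on the possible gain in hull edges, the inner one on the length of the
  -- final run of inner points. Truncated subtraction is harmless since the count never exceeds
  -- `T.card`.
  generalize hN : T.card - cnt (X.HullEdge T) (s :: v :: m) = N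
  induction N using Nat.strong_induction_on generalizing v m with
  | _ N ihN =>
  subst hN
  have hcard : ∀ {l}, X.Path T l → cnt (X.HullEdge T) l < T.card + 1 := by
    classical
    intro l hl
    have : l.toFinset = T := by ext x; simp [hl.2.1]
    rw [← this, List.toFinset_card_of_nodup hl.1]
    exact Nat.lt_succ_of_le (cnt_le_length _ _)
  have hhead : ∀ {l}, X.Reach (s :: v :: m) l → ∃ v' m', l = s :: v' :: m' := by
    intro l h
    obtain ⟨B, rfl⟩ := h.cons
    have := h.perm.length_eq
    rcases B with _ | ⟨v', m'⟩
    · simp at this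
    · exact ⟨v', m', rfl⟩
  have hstep : ∀ P w R, X.Reach (s :: v :: m) (P ++ w :: R) →
      cnt (X.HullEdge T) (P ++ w :: R) = cnt (X.HullEdge T) (s :: v :: m) →
      ¬ X.Inner T w → (∀ x ∈ R, X.Inner T x) → Good X T s (s :: v :: m) := by
    intro P w R
    generalize hk : R.length = k
    induction k using Nat.strong_induction_on generalizing P w R with
    | _ k ihk =>
    subst hk
    intro hreach hcnt hw hR
    have hl' := hl.of_reach hreach
    obtain ⟨v', m', hhd⟩ := hhead hreach
    rcases R with _ | ⟨u, M⟩
    · -- the last point is not inner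
      rcases P.eq_nil_or_concat with rfl | ⟨A, c, rfl⟩
      · simp at hhd
      rw [List.concat_eq_append] at *
      rcases good_or_increase (c := c) hhd ⟨A, by simp⟩ hs hl' hw with h | ⟨l', h1, h2⟩
      · exact h.of_reach hreach
      · obtain ⟨v'', m'', rfl⟩ := hhead (hreach.trans h1)
        have hl'' := hl'.of_reach h1
        have := hcard hl''
        exact (ihN _ (by omega) hl'' rfl).of_reach (hreach.trans h1)
    · have hsplit : ∀ L : List V, P ++ w :: L = (P ++ [w]) ++ L := by simp
      by_cases hne : ∃ a b, Adj (P ++ [w]) a b ∧ ¬ X.HullEdge T a b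
      · obtain ⟨R, r, h1, a, b, hab, hHE, ha, hb⟩ := exists_last_sees h2 hmain hl' hR hne
        have hp : (u :: M).Perm (R ++ [r]) := by
          have := h1.perm
          rwa [List.perm_append_left_iff, List.perm_cons] at this
        have hlen := hp.length_eq
        have hl1 := hl'.of_reach h1
        have hin : ∀ x ∈ R ++ [r], X.Inner T x := fun x hx => hR x (hp.mem_iff.2 hx)
        -- Every edge behind `w` has an inner end and is not a hull edge, so reordering the run
        -- keeps the count.
        have hcnt1 : cnt (X.HullEdge T) (P ++ w :: (R ++ [r])) =
            cnt (X.HullEdge T) (P ++ w :: u :: M) := by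
          have : ∀ L, (∀ x ∈ L, X.Inner T x) → (P ++ w :: L).Nodup →
              cnt (X.HullEdge T) (w :: L) = 0 := by
            intro L hL hn
            refine cnt_eq_zero _ fun x y hxy h => ?_
            have hn' := (List.nodup_append.1 hn).2.1
            refine h.not_inner_right (Adj.ne hn' (.inl hxy)) (hL y ?_)
            obtain ⟨C, D, h⟩ := (nx_iff _ _ _).1 hxy
            rcases C with _ | ⟨z, C⟩
            · simp only [List.nil_append, List.cons.injEq] at h; rw [h.2]; simp
            · simp only [List.cons_append, List.cons.injEq] at h; rw [h.2]; simp
          rw [cnt_append _ P w (R ++ [r]), cnt_append _ P w (u :: M), this _ hin hl1.1,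
            this _ hR hl'.1]
        have fin : ∀ a b C D, P ++ [w] = C ++ a :: b :: D → ¬ X.HullEdge T a b →
            X.Unc (Adj (P ++ w :: (R ++ [r]))) r a → X.Unc (Adj (P ++ w :: (R ++ [r]))) r b →
            Good X T s (s :: v :: m) := by
          intro a b C D hCD hHE ha hb
          have e : P ++ w :: (R ++ [r]) = C ++ a :: b :: ((D ++ R) ++ [r]) := by
            rw [hsplit, hCD]; simp
          rw [e] at ha hb hl1 h1 hcnt1
          obtain ⟨h3, h4⟩ := reach_insert hl1 ha hb (hin r (by simp)) hHE
          -- The point `r` is inserted before the end of `P ++ [w]`, so `w` still precedes the run,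
          -- now one point shorter.
          obtain ⟨P', hP'⟩ : ∃ P', C ++ a :: r :: b :: D = P' ++ [w] := by
            rcases D.eq_nil_or_concat with rfl | ⟨D', w', rfl⟩
            · have : b = w := by
                have h : P ++ [w] = (C ++ [a]) ++ [b] := by simp [hCD]
                simpa using (List.append_inj' h rfl).2.symm
              subst this
              exact ⟨C ++ [a, r], by simp⟩
            · rw [List.concat_eq_append] at hCD ⊢
              have : w' = w := by
                have h : P ++ [w] = (C ++ a :: b :: D') ++ [w'] := by simp [hCD]
                simpa using (List.append_inj' h rfl).2.symm
              subst this
              exact ⟨C ++ a :: r :: b :: D', by simp⟩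
          have e' : C ++ a :: r :: b :: (D ++ R) = P' ++ w :: R := by
            have : C ++ a :: r :: b :: (D ++ R) = (C ++ a :: r :: b :: D) ++ R := by simp
            rw [this, hP']; simp
          rw [e'] at h3 h4
          refine ihk R.length (by simp at hlen ⊢; omega) P' w R rfl
            (hreach.trans (h1.trans h3)) (by omega) hw fun x hx => hin x (by simp [hx])
        rcases hab with hab | hab
        · obtain ⟨C, D, h⟩ := (nx_iff _ _ _).1 hab
          exact fin a b C D h hHE ha hb
        · obtain ⟨C, D, h⟩ := (nx_iff _ _ _).1 hab
          exact fin b a C D h (fun h => hHE h.symm) hb ha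
      · -- all edges of the initial part are hull edges
        push Not at hne
        -- With `P` empty all points but `s` would be inner, whereas a hull neighbour of `s` is not.
        -- Otherwise the first edge belongs to the initial part.
        rcases P with _ | ⟨s', P⟩
        · simp only [List.nil_append, List.cons.injEq] at hhd
          obtain ⟨rfl, -⟩ := hhd
          have hu : u ∈ T := (hl'.2.1 u).1 (by simp)
          have huw : u ≠ w := by
            have := hl'.1
            simp only [List.nil_append, List.nodup_cons, List.mem_cons] at this
            tauto
          obtain ⟨a, ha, haw, h⟩ := exists_hull_neighbor ((hl'.2.1 w).1 (by simp)) hs hu huw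
          have haR : a ∈ u :: M := by
            have := (hl'.2.1 a).2 ha
            rw [List.nil_append, List.mem_cons] at this
            tauto
          exact ((hullEdge_of_forall h).not_inner_right haw.symm (hR a haR)).elim
        · refine ⟨v', m', hhd ▸ hreach, hne s v' ?_⟩
          rcases P with _ | ⟨p, P⟩ <;>
            simp only [List.cons_append, List.nil_append, List.cons.injEq] at hhd <;>
            simp [hhd]
  obtain ⟨P, w, R, h, hw, hR⟩ := exists_run (P := X.Inner T) (l := s :: v :: m) ⟨s, by simp, hs⟩
  exact hstep P w R (h ▸ .refl) (by rw [h]) hw hR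

theorem Path.tail [DecidableEq V] {s : V} {l : List V} (h : X.Path T (s :: l)) :
    X.Path (T.erase s) l := by
  refine ⟨(List.nodup_cons.1 h.1).2, fun x => ?_, h.2.2.of_append_right (A := [s])⟩
  rw [Finset.mem_erase, ← h.2.1, List.mem_cons]
  have := (List.nodup_cons.1 h.1).1
  grind

/-! ### Angular order and the induction on the number of points. -/

/-- A list in angular order around `s` is a plane path. -/
theorem plane_of_pairwise {s : V} {l : List V} (h : l.Pairwise fun x y => X.o s x y = true) :
    X.Plane l := by
  induction l with
  | nil => intro a b c d h; simp at h
  | cons a l ih =>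
    rcases l with _ | ⟨b, l⟩
    · intro a b c d h; simp at h
    · have h' := List.pairwise_cons.1 h
      have h'' := List.pairwise_cons.1 h'.2
      have hab := h'.1 b (by simp)
      refine (ih h'.2).insert (x := a) (y := b) (fun x y hxy hc => ?_)
        fun x y hxy => by rw [adj_cons_cons] at hxy; tauto
      have n := hc.nodup
      have hm := hxy.mem
      have hx := h'.1 x hm.1
      have hy := h'.1 y hm.2
      simp only [List.mem_cons] at hm
      have hbx := h''.1 x (hm.1.resolve_left (by grind))
      have hby := h''.1 y (hm.2.resolve_left (by grind))
      have e1 := X.ne_of_o hbx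
      have e2 := X.ne_of_o hby
      have e3 := X.ne_of_o hab
      exact of_decide_eq_true (X.five (a := s) (b := a) (c := b) (d := x) (e := y)
        (by clear * - n e1 e2 e3; grind)
        (fun o => decide (o 0 1 2 = true → o 0 1 3 = true → o 0 1 4 = true → o 0 2 3 = true →
          o 0 2 4 = true → ¬ cross o 3 4 1 2 = true)) (by decide +kernel)) hab hx hy hbx hby hc

/-- Successively split off the hull neighbour of `s` that has all remaining points on its left. -/
theorem exists_angular_list {s : V} (hs : s ∈ T) (hi : ¬ X.Inner T s) :
    ∃ m : List V, (∀ x, x ∈ m ↔ x ∈ T ∧ x ≠ s) ∧ m.Pairwise fun x y => X.o s x y = true := by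
  classical
  induction hn : T.card generalizing T with
  | zero => simp_all
  | succ n ih =>
    by_cases hq : ∃ q ∈ T, q ≠ s
    · obtain ⟨q, hq, hqs⟩ := hq
      obtain ⟨a, ha, has, h⟩ := exists_hull_neighbor hs hi hq hqs
      obtain ⟨m, hm, hp⟩ := ih (T := T.erase a) (by simp [hs, has.symm])
        (fun h => hi (h.mono (Finset.erase_subset _ _)))
        (by rw [Finset.card_erase_of_mem ha]; omega)
      refine ⟨a :: m, fun x => ?_, List.pairwise_cons.2 ⟨fun x hx => ?_, hp⟩⟩
      · rw [List.mem_cons, hm, Finset.mem_erase]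
        grind
      · rw [hm, Finset.mem_erase] at hx
        exact h x hx.1.2 hx.2 hx.1.1
    · push Not at hq
      exact ⟨[], fun x => by simpa using hq x, .nil⟩

/-- In a two-layer set, the plane paths from a hull point are connected by flips. -/
theorem connected_of_twoLayers (h2 : X.TwoLayers T) {s : V} (hsT : s ∈ T) (hs : ¬ X.Inner T s) :
    X.Connected T s := by
  classical
  induction hn : T.card using Nat.strong_induction_on generalizing T s with
  | _ n ih =>
  subst hn
  -- A set of inner points is in convex position by `h2` and omits `s`, so the induction hypothesis
  -- covers it.
  have hmain : ∀ U : Finset V, (∀ x ∈ U, X.Inner T x) → ∀ u ∈ U, X.Connected U u := by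
    intro U hU u hu
    have hno : ∀ x, ¬ X.Inner U x := fun x ⟨hx, p, hp, q, hq, z, hz, ht⟩ =>
      h2 _ _ _ _ (hU x hx) (hU p hp) (hU q hq) (hU z hz) ht
    refine ih _ (Finset.card_lt_card ?_) (fun p _ _ _ hp => (hno p hp).elim) hu (hno u) rfl
    rw [Finset.ssubset_iff_of_subset fun x hx => (hU x hx).1]
    exact ⟨s, hsT, fun h => hs (hU s h)⟩
  have hmono : ∀ {x}, X.Inner (T.erase s) x → X.Inner T x := fun h =>
    h.mono (Finset.erase_subset _ _)
  -- Delete `s`: the hull edge `sv` makes `v` a hull point of the rest and crosses nothing when `s`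
  -- is put back.
  have herase : ∀ {v m m'}, X.HullEdge T s v → X.Path T (s :: v :: m) → X.Path T (s :: v :: m') →
      X.Reach (s :: v :: m) (s :: v :: m') := by
    intro v m m' hv h h'
    have hsv : s ≠ v := fun e => by have := h.1; rw [e] at this; simp at this
    have hvT : v ∈ T := (h.2.1 v).1 (by simp)
    have hr := ih _ (Finset.card_erase_lt_of_mem hsT)
      (fun p a b c hp ha hb hc => h2 p a b c (hmono hp) (hmono ha) (hmono hb) (hmono hc))
      (s := v) (T := T.erase s) (by simp [hvT, hsv.symm])
      (fun h => hv.not_inner_right hsv (hmono h)) rfl _ _ h.tail h'.tail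
    refine hr.lift (A := [s]) h.tail.2.2 fun C hC hCp => ?_
    exact (Path.cons hsT ⟨hC.symm.nodup h.tail.1, fun x => by rw [hC.mem_iff, h.tail.2.1], hCp⟩
      hv).2.2
  obtain ⟨m₀, hm₀, hp₀⟩ := exists_angular_list hsT hs
  have hnodup : m₀.Nodup := hp₀.imp fun h => (X.ne_of_o h).2.1
  -- The hull neighbours of `s` are exactly the two ends of the angular list.
  have hends : ∀ C v D, m₀ = C ++ v :: D → (C = [] ∨ D = [] ↔ X.HullEdge T s v) := by
    intro C v D hCD
    have hp := hp₀
    rw [hCD, List.pairwise_append, List.pairwise_cons] at hp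
    have hT : ∀ x, x ∈ C ∨ x = v ∨ x ∈ D → x ∈ T ∧ x ≠ s := fun x hx => (hm₀ x).1 (by
      rw [hCD]; simpa using hx)
    have hCv : ∀ x ∈ C, X.o s x v = true := fun x hx => hp.2.2 x hx v (by simp)
    have hvD : ∀ x ∈ D, X.o s v x = true := hp.2.1.1
    constructor
    · intro h z hz w hw h1 h2 h3 h4
      have hz' : z ∈ m₀ := (hm₀ z).2 ⟨hz, h1⟩
      have hw' : w ∈ m₀ := (hm₀ w).2 ⟨hw, h3⟩
      rw [hCD, List.mem_append, List.mem_cons] at hz' hw'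
      rcases h with rfl | rfl
      · rw [hvD z (by simpa [h2] using hz'), hvD w (by simpa [h4] using hw')]
      · have e1 := hCv z (by simpa [h2] using hz')
        have e2 := hCv w (by simpa [h4] using hw')
        have := X.perms (X.ne_of_o e1)
        have := X.perms (X.ne_of_o e2)
        grind
    · intro h
      by_contra hcon
      push Not at hcon
      obtain ⟨x, hx⟩ := List.exists_mem_of_ne_nil C hcon.1
      obtain ⟨y, hy⟩ := List.exists_mem_of_ne_nil D hcon.2
      have e1 := hCv x hx
      have e2 := hvD y hy
      have := h x (hT x (.inl hx)).1 y (hT y (.inr (.inr hy))).1 (hT x (.inl hx)).2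
        (X.ne_of_o e1).2.1 (hT y (.inr (.inr hy))).2 (X.ne_of_o e2).2.1.symm
      grind [X.perms (X.ne_of_o e1)]
  have hplane : X.Plane (s :: m₀) ∧ X.Plane (s :: m₀.reverse) := by
    have hpl := plane_of_pairwise hp₀
    have aux : ∀ v l, X.Plane (v :: l) → X.HullEdge T s v → (∀ x ∈ v :: l, x ∈ T) →
        X.Plane (s :: v :: l) := fun v l h hv hT =>
      h.insert (x := s) (y := v)
        (fun x y hxy hc => hv.not_cr (hT x hxy.mem.1) (hT y hxy.mem.2) hc.symm)
        fun x y hxy => by rw [adj_cons_cons] at hxy; tauto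
    constructor
    · rcases m₀ with _ | ⟨v, l⟩
      · intro a b c d h; simp at h
      · exact aux v l hpl ((hends [] v l rfl).1 (.inl rfl)) fun x hx => ((hm₀ x).1 hx).1
    · rcases m₀.eq_nil_or_concat with rfl | ⟨l, v, rfl⟩
      · intro a b c d h; simp at h
      · rw [List.concat_eq_append] at *
        have := hpl.reverse
        rw [List.reverse_append, List.reverse_singleton, List.singleton_append] at this ⊢
        refine aux v _ this ((hends l v [] rfl).1 (.inr rfl)) fun x hx => ((hm₀ x).1 ?_).1
        simpa [or_comm] using hx
  have hpath : X.Path T (s :: m₀) ∧ X.Path T (s :: m₀.reverse) := by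
    refine ⟨⟨?_, ?_, hplane.1⟩, ⟨?_, ?_, hplane.2⟩⟩ <;>
      simp only [List.nodup_cons, List.mem_cons, List.mem_reverse, hm₀, List.nodup_reverse] <;>
      grind
  have hflip : X.Reach (s :: m₀) (s :: m₀.reverse) :=
    .single ⟨hplane.1, hplane.2, [], s, m₀, rfl, rfl⟩
  have key : ∀ m, X.Path T (s :: m) → X.Reach (s :: m) (s :: m₀) := by
    intro m hm
    rcases m with _ | ⟨v, m⟩
    · rcases m₀ with _ | ⟨x, l⟩
      · exact .refl
      · have := (hpath.1.2.1 x).1 (by simp)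
        rw [← hm.2.1] at this
        simp only [List.mem_singleton] at this
        exact (((hm₀ x).1 (by simp)).2 this).elim
    · obtain ⟨v', m', h1, h3⟩ := exists_good h2 hs hmain hm
      have hm' := hm.of_reach h1
      have hv' : v' ∈ m₀ := (hm₀ v').2 ⟨(hm'.2.1 v').1 (by simp), fun e => by
        have := hm'.1; rw [e] at this; simp at this⟩
      obtain ⟨C, D, hCD⟩ := List.append_of_mem hv'
      refine h1.trans ?_
      rcases (hends C v' D hCD).2 h3 with rfl | rfl
      · have := hpath.1
        rw [hCD] at this ⊢
        exact herase h3 hm' this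
      · refine Reach.trans ?_ hflip.symm
        have := hpath.2
        rw [hCD] at this ⊢
        rw [List.reverse_append, List.reverse_singleton, List.singleton_append] at this ⊢
        exact herase h3 hm' this
  intro m m' hm hm'
  exact (key m hm).trans (key m' hm').symm

/-- There is a plane path from each hull point. -/
theorem exists_path {s : V} (hsT : s ∈ T) (hs : ¬ X.Inner T s) : ∃ m, X.Path T (s :: m) := by
  obtain ⟨m, hm, hp⟩ := exists_angular_list hsT hs
  refine ⟨m, ?_, fun x => by rw [List.mem_cons, hm]; grind, ?_⟩
  · exact List.nodup_cons.2 ⟨fun h => ((hm s).1 h).2 rfl, hp.imp fun h => (X.ne_of_o h).2.1⟩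
  · rcases m with _ | ⟨v, l⟩
    · intro a b c d h; simp at h
    · have hv := (List.pairwise_cons.1 hp).1
      have hHE : X.HullEdge T s v := hullEdge_of_forall fun z hz h1 h2 =>
        hv z (by simpa [h2] using (hm z).2 ⟨hz, h1⟩)
      exact (plane_of_pairwise hp).insert (x := s) (y := v)
        (fun x y hxy hc => hHE.not_cr ((hm x).1 hxy.mem.1).1 ((hm y).1 hxy.mem.2).1 hc.symm)
        fun x y hxy => by rw [adj_cons_cons] at hxy; tauto

end CCSystem

/-! ### Orientation by determinants, and layers. -/

namespace PlanePath

open CCSystem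

/-- Twice the signed area of the triangle `a b c`. -/
def det (a b c : Plane) : ℝ := (b 0 - a 0) * (c 1 - a 1) - (b 1 - a 1) * (c 0 - a 0)

theorem collinear_of_det_eq_zero {a b c : Plane} (hab : a ≠ b) (h : det a b c = 0) :
    Collinear ℝ ({a, b, c} : Set Plane) := by
  rw [collinear_iff_of_mem (p₀ := a) (by simp)]
  refine ⟨b - a, ?_⟩
  have hv : b 0 - a 0 ≠ 0 ∨ b 1 - a 1 ≠ 0 := by
    by_contra hcon
    push Not at hcon
    refine hab (PiLp.ext fun i => ?_)
    fin_cases i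
    · exact (sub_eq_zero.1 hcon.1).symm
    · exact (sub_eq_zero.1 hcon.2).symm
  unfold det at h
  intro p hp
  rcases hp with rfl | rfl | rfl
  · exact ⟨0, by simp⟩
  · exact ⟨1, by simp⟩
  · rcases hv with hv | hv
    · refine ⟨(p 0 - a 0) / (b 0 - a 0), PiLp.ext fun i => ?_⟩
      fin_cases i
      · simp; field_simp; ring
      · simp; field_simp; linarith
    · refine ⟨(p 1 - a 1) / (b 1 - a 1), PiLp.ext fun i => ?_⟩
      fin_cases i
      · simp; field_simp; linarith
      · simp; field_simp; ring

theorem det_ne_zero {S : Finset Plane} (hS : GeneralPosition S) {a b c : S} (h1 : a ≠ b)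
    (h2 : b ≠ c) (h3 : a ≠ c) : det a b c ≠ 0 := fun h =>
  hS a a.2 b b.2 c c.2 (Subtype.coe_injective.ne h1) (Subtype.coe_injective.ne h3)
    (Subtype.coe_injective.ne h2) (collinear_of_det_eq_zero (Subtype.coe_injective.ne h1) h)

theorem decide_pos_beq {u v : ℝ} (hu : u ≠ 0) (hv : v ≠ 0) :
    (decide (0 < u) == decide (0 < v)) = decide (0 < u * v) := by
  rcases lt_or_gt_of_ne hu with h1 | h1 <;> rcases lt_or_gt_of_ne hv with h2 | h2
  · simp [mul_pos_of_neg_of_neg h1 h2, h1.not_gt, h2.not_gt]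
  · simp [(mul_neg_of_neg_of_pos h1 h2).not_gt, h1.not_gt, h2]
  · simp [(mul_neg_of_pos_of_neg h1 h2).not_gt, h1, h2.not_gt]
  · simp [mul_pos h1 h2, h1, h2]

theorem decide_pos_add {w x y : ℝ} (hw : w ≠ 0) (hx : x ≠ 0) (hy : y ≠ 0) :
    (!(decide (0 < w) == decide (0 < x) && decide (0 < x) == decide (0 < y) &&
      decide (0 < w + x + y) != decide (0 < w))) = true := by
  rcases lt_or_gt_of_ne hw with h1 | h1 <;> rcases lt_or_gt_of_ne hx with h2 | h2 <;>
    rcases lt_or_gt_of_ne hy with h3 | h3 <;> simp [h1, h2, h3, h1.not_gt, h2.not_gt, h3.not_gt] <;>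
    linarith

theorem decide_pos_gp {w x y : ℝ} (hw : w ≠ 0) (hx : x ≠ 0) (hy : y ≠ 0) (h : w - x + y = 0) :
    (!(decide (0 < w) == (!decide (0 < x)) && decide (0 < w) == decide (0 < y))) = true := by
  rcases lt_or_gt_of_ne hw with h1 | h1 <;> rcases lt_or_gt_of_ne hx with h2 | h2 <;>
    rcases lt_or_gt_of_ne hy with h3 | h3 <;> simp [h1, h2, h3, h1.not_gt, h2.not_gt, h3.not_gt] <;>
    linarith

/-- Points of the plane in general position, with their orientation. -/
noncomputable def orientation (S : Finset Plane) (hS : GeneralPosition S) : CCSystem S where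
  o a b c := decide (0 < det a b c)
  rot a b c := by
    have : det b c a = det a b c := by unfold det; ring
    rw [this]
  deg a b := by simp [det]
  swap a b c h1 h2 h3 := by
    have h : det b a c = - det a b c := by unfold det; ring
    rw [h]
    rcases lt_or_gt_of_ne (det_ne_zero hS h1 h2 h3) with h | h <;> simp [h, h.le]
  acyclic a b c x hn := by
    -- Additivity of signed area: three summands of the same sign determine the sign of the sum.
    have h : det a b c = det a b x + det b c x + det c a x := by unfold det; ring
    simp only [List.nodup_cons, List.mem_cons, List.not_mem_nil, not_or, or_false] at hn
    obtain ⟨⟨h1, h2, h3⟩, ⟨h4, h5⟩, h6, -⟩ := hn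
    rw [h]
    exact decide_pos_add (det_ne_zero hS h1 h5 h3) (det_ne_zero hS h4 h6 h5)
      (det_ne_zero hS (Ne.symm h2) h3 h6)
  gp r a b c d hn := by
    -- The three-term Grassmann–Plücker relation: the signed terms cannot all have the same sign.
    have h : det r a b * det r c d - det r a c * det r b d + det r a d * det r b c = 0 := by
      unfold det; ring
    simp only [List.nodup_cons, List.mem_cons, List.not_mem_nil, not_or, or_false] at hn
    obtain ⟨⟨h1, h2, h3, h4⟩, ⟨h5, h6, h7⟩, ⟨h8, h9⟩, h10, -⟩ := hn
    have e1 := det_ne_zero hS h1 h5 h2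
    have e2 := det_ne_zero hS h3 h10 h4
    have e3 := det_ne_zero hS h1 h6 h3
    have e4 := det_ne_zero hS h2 h9 h4
    have e5 := det_ne_zero hS h1 h7 h4
    have e6 := det_ne_zero hS h2 h8 h3
    rw [bne, decide_pos_beq e1 e2, decide_pos_beq e3 e4, decide_pos_beq e5 e6]
    exact decide_pos_gp (mul_ne_zero e1 e2) (mul_ne_zero e3 e4) (mul_ne_zero e5 e6) h

/-- The barycentric coordinates of `q` are quotients of determinants, by Cramer's rule. -/
theorem mem_convexHull_of_det {a b c q : Plane} (h1 : 0 < det a b q) (h2 : 0 < det b c q)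
    (h3 : 0 < det c a q) : q ∈ convexHull ℝ ({a, b, c} : Set Plane) := by
  have hs : det a b c = det a b q + det b c q + det c a q := by unfold det; ring
  have hpos : 0 < det a b c := by rw [hs]; positivity
  have hq : q = ∑ i : Fin 3, (![det b c q / det a b c, det c a q / det a b c,
      det a b q / det a b c] i) • (![a, b, c] i) := by
    refine PiLp.ext fun i => ?_
    rw [Fin.sum_univ_three]
    fin_cases i <;> simp <;> field_simp <;> unfold det <;> ring
  rw [hq]
  refine (convex_convexHull ℝ _).sum_mem (fun i _ => ?_) ?_ fun i _ => subset_convexHull ℝ _ ?_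
  · fin_cases i <;> simp <;> positivity
  · rw [Fin.sum_univ_three]
    simp
    field_simp
    linarith
  · fin_cases i <;> simp

theorem isOpen_det_pos (a b : Plane) : IsOpen {q : Plane | 0 < det a b q} := by
  unfold det
  exact isOpen_lt continuous_const (by fun_prop)

theorem mem_interior_of_det {A : Set Plane} {a b c p : Plane} (ha : a ∈ A) (hb : b ∈ A)
    (hc : c ∈ A) (h1 : 0 < det a b p) (h2 : 0 < det b c p) (h3 : 0 < det c a p) :
    p ∈ interior (convexHull ℝ A) := by
  refine interior_maximal (s := convexHull ℝ A) (t := {q | 0 < det a b q} ∩ {q | 0 < det b c q} ∩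
    {q | 0 < det c a q}) (fun q hq => ?_)
    (((isOpen_det_pos a b).inter (isOpen_det_pos b c)).inter (isOpen_det_pos c a))
    ⟨⟨h1, h2⟩, h3⟩
  refine convexHull_mono ?_ (mem_convexHull_of_det hq.1.1 hq.1.2 hq.2)
  rintro x (rfl | rfl | rfl) <;> assumption

variable {S : Finset Plane} {hS : GeneralPosition S}

theorem mem_interior_of_tri {A : Set Plane} {p a b c : S} (ha : (a : Plane) ∈ A)
    (hb : (b : Plane) ∈ A) (hc : (c : Plane) ∈ A) (h : (orientation S hS).Tri p a b c) :
    (p : Plane) ∈ interior (convexHull ℝ A) := by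
  simp only [Tri, tri, orientation, Bool.or_eq_true, Bool.and_eq_true, decide_eq_true_eq] at h
  rcases h with ⟨⟨h1, h2⟩, h3⟩ | ⟨⟨h1, h2⟩, h3⟩
  · exact mem_interior_of_det ha hb hc h1 h2 h3
  · exact mem_interior_of_det hb ha hc h1 h3 h2

theorem mem_outerPoints_iff {A : Set Plane} {p : Plane} :
    p ∈ outerPoints A ↔ p ∈ A ∧ p ∉ interior (convexHull ℝ A) := by
  simp only [outerPoints, frontier, Set.mem_ofPred_eq, Set.mem_sdiff]
  exact and_congr_right fun h => and_iff_right (subset_closure (subset_convexHull ℝ A h))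

/-- A point with largest coordinate `0` is not interior: a small push in that direction leaves the
half-plane containing the hull. -/
theorem outerPoints_nonempty {A : Set Plane} (hf : A.Finite) (hA : A.Nonempty) :
    (outerPoints A).Nonempty := by
  obtain ⟨x, hx, hmax⟩ := Set.exists_max_image A (fun q : Plane => q 0) hf hA
  refine ⟨x, mem_outerPoints_iff.2 ⟨hx, fun hint => ?_⟩⟩
  have hsub : convexHull ℝ A ⊆ {q : Plane | q 0 ≤ x 0} := by
    refine convexHull_min hmax ?_
    exact convex_halfSpace_le (f := fun q : Plane => q 0) ⟨fun _ _ => rfl, fun _ _ => rfl⟩ _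
  obtain ⟨ε, hε, hball⟩ := Metric.isOpen_iff.1 isOpen_interior x hint
  have : x + EuclideanSpace.single 0 (ε / 2) ∈ Metric.ball x ε := by
    rw [Metric.mem_ball, dist_eq_norm, add_sub_cancel_left, PiLp.norm_single,
      Real.norm_eq_abs, abs_of_pos (by positivity)]
    linarith
  have := hsub (interior_subset (hball this))
  simp at this
  linarith

theorem inner_mem_peel {p : S} (h : (orientation S hS).Inner Finset.univ p) :
    (p : Plane) ∈ peel (S : Set Plane) 1 := by
  obtain ⟨-, a, -, b, -, c, -, ht⟩ := h
  refine ⟨p.2, fun hout => ?_⟩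
  exact (mem_outerPoints_iff.1 hout).2 (mem_interior_of_tri (A := (S : Set Plane)) a.2 b.2 c.2 ht)

/-- An inner point inside a triangle of inner points survives two peelings, so the layers `0`, `1`
and `2` would all be non-empty. -/
theorem twoLayers_of_layerNumber (hL : layerNumber (S : Set Plane) ≤ 2) :
    (orientation S hS).TwoLayers Finset.univ := by
  intro p a b c hp ha hb hc ht
  have hp2 : (p : Plane) ∈ peel (S : Set Plane) 2 := ⟨inner_mem_peel hp, fun hout =>
    (mem_outerPoints_iff.1 hout).2 (mem_interior_of_tri (inner_mem_peel ha) (inner_mem_peel hb)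
      (inner_mem_peel hc) ht)⟩
  have hlay : ∀ i, (p : Plane) ∈ peel (S : Set Plane) i → (layer (S : Set Plane) i).Nonempty := by
    intro i hi
    refine outerPoints_nonempty ?_ ⟨_, hi⟩
    clear hi
    induction i with
    | zero => exact S.finite_toSet
    | succ i ih => exact ih.subset Set.sdiff_subset
  have hsub : ((({0, 1, 2} : Finset ℕ) : Set ℕ)) ⊆ {i : ℕ | (layer (S : Set Plane) i).Nonempty} := by
    intro i hi
    simp only [Finset.coe_insert, Finset.coe_singleton, Set.mem_insert_iff,
      Set.mem_singleton_iff] at hi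
    rcases hi with rfl | rfl | rfl
    · exact hlay 0 p.2
    · exact hlay 1 hp2.1
    · exact hlay 2 hp2
  have := (Set.encard_le_encard hsub).trans hL
  rw [Set.encard_coe_eq_coe_finsetCard] at this
  revert this
  decide

theorem not_inner_of_layer {s : S} (hs : (s : Plane) ∈ layer (S : Set Plane) 0) :
    ¬ (orientation S hS).Inner Finset.univ s := fun h => (inner_mem_peel h).2 hs

/-! ### Crossings as intersections of segments. -/

theorem det_line (a b c d : Plane) (u : ℝ) :
    det a b (AffineMap.lineMap c d u) = (1 - u) * det a b c + u * det a b d := by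
  simp [det, AffineMap.lineMap_apply]
  ring

/-- Crossing pairs have a common point. -/
theorem segments_meet_of_cr {a b c d : S} (h : (orientation S hS).Cr a b c d) :
    (segment ℝ (a : Plane) b ∩ segment ℝ (c : Plane) d).Nonempty := by
  have h1 : det a b c * det a b d < 0 ∧ det c d a * det c d b < 0 := by
    have e1 : ∀ x, det (b : Plane) a x = - det a b x := fun x => by unfold det; ring
    have e2 : ∀ x, det (d : Plane) c x = - det c d x := fun x => by unfold det; ring
    simp only [Cr, cross, orientation, Bool.or_eq_true, Bool.and_eq_true, decide_eq_true_eq, e1, e2,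
      Left.neg_pos_iff] at h
    refine ⟨?_, ?_⟩
    · rcases h.1 with h | h <;> nlinarith
    · rcases h.2 with h | h <;> nlinarith
  have hne : det a b c - det a b d ≠ 0 := fun h => by
    have := h1.1
    rw [sub_eq_zero.1 h] at this
    nlinarith [mul_self_nonneg (det (a : Plane) b d)]
  have hs : det c d a - det c d b = det a b d - det a b c := by unfold det; ring
  have hne' : det c d a - det c d b ≠ 0 := by rw [hs, ← neg_sub]; exact neg_ne_zero.2 hne
  have hin : ∀ x y : ℝ, x * y < 0 → x - y ≠ 0 → 0 ≤ x / (x - y) ∧ x / (x - y) ≤ 1 := by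
    intro x y h h'
    rcases mul_neg_iff.1 h with ⟨h1, h2⟩ | ⟨h1, h2⟩
    · exact ⟨div_nonneg h1.le (by linarith), (div_le_one (by linarith)).2 (by linarith)⟩
    · exact ⟨div_nonneg_of_nonpos h1.le (by linarith),
        (div_le_one_of_neg (by linarith)).2 (by linarith)⟩
  -- The parameter is the zero of the affine function `det a b` along the line `cd`.
  refine ⟨AffineMap.lineMap (c : Plane) d (det a b c / (det a b c - det a b d)), ?_, ?_⟩
  · have e : AffineMap.lineMap (c : Plane) d (det a b c / (det a b c - det a b d)) =
        AffineMap.lineMap (a : Plane) b (det c d a / (det c d a - det c d b)) := by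
      refine PiLp.ext fun i => ?_
      simp only [AffineMap.lineMap_apply, hs, vsub_eq_sub, vadd_eq_add, PiLp.add_apply,
        PiLp.smul_apply, PiLp.sub_apply, smul_eq_mul]
      rw [hs] at hne'
      field_simp
      fin_cases i <;> simp [det] <;> ring
    rw [e, segment_eq_image_lineMap]
    exact ⟨_, hin _ _ h1.2 hne', rfl⟩
  · rw [segment_eq_image_lineMap]
    exact ⟨_, hin _ _ h1.1 hne, rfl⟩

/-- At the common point `det a b` vanishes, and it is also a convex combination of its non-zero
values at `c` and `d`. -/
theorem mul_det_neg {a b c d : S} (hn : [a, b, c, d].Nodup)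
    (h : (segment ℝ (a : Plane) b ∩ segment ℝ (c : Plane) d).Nonempty) (hS : GeneralPosition S) :
    det a b c * det a b d < 0 := by
  obtain ⟨p, h1, h2⟩ := h
  rw [segment_eq_image_lineMap] at h1 h2
  obtain ⟨t, ht, rfl⟩ := h1
  obtain ⟨u, hu, h⟩ := h2
  have e1 := det_line (a : Plane) b a b t
  have e2 := det_line (a : Plane) b c d u
  rw [h, e1] at e2
  have e3 : det (a : Plane) b a = 0 := by unfold det; ring
  have e4 : det (a : Plane) b b = 0 := by unfold det; ring
  rw [e3, e4] at e2
  simp only [List.nodup_cons, List.mem_cons, List.not_mem_nil, not_or, or_false] at hn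
  obtain ⟨⟨h1, h2, h3⟩, ⟨h4, h5⟩, h6, -⟩ := hn
  have f1 := det_ne_zero hS h1 h4 h2
  have f2 := det_ne_zero hS h1 h5 h3
  obtain ⟨hu0, hu1⟩ := hu
  by_contra hcon
  rcases lt_or_gt_of_ne f1 with g1 | g1 <;> rcases lt_or_gt_of_ne f2 with g2 | g2
  · have : (1 - u) * det a b c + u * det a b d < 0 := by
      rcases hu0.eq_or_lt with rfl | hu0
      · linarith
      · nlinarith [mul_neg_of_pos_of_neg hu0 g2]
    linarith
  · exact hcon (mul_neg_of_neg_of_pos g1 g2)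
  · exact hcon (mul_neg_of_pos_of_neg g1 g2)
  · have : 0 < (1 - u) * det a b c + u * det a b d := by
      rcases hu0.eq_or_lt with rfl | hu0
      · linarith
      · nlinarith [mul_pos hu0 g2]
    linarith

/-- Disjoint pairs whose segments have a common point cross. -/
theorem cr_of_segments_meet {a b c d : S} (hn : [a, b, c, d].Nodup)
    (h : (segment ℝ (a : Plane) b ∩ segment ℝ (c : Plane) d).Nonempty) :
    (orientation S hS).Cr a b c d := by
  have h1 := mul_det_neg hn h hS
  have h2 := mul_det_neg (a := c) (b := d) (c := a) (d := b) (by grind)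
    (by rwa [Set.inter_comm]) hS
  have e1 : ∀ x, det (b : Plane) a x = - det a b x := fun x => by unfold det; ring
  have e2 : ∀ x, det (d : Plane) c x = - det c d x := fun x => by unfold det; ring
  simp only [Cr, cross, orientation, Bool.or_eq_true, Bool.and_eq_true, decide_eq_true_eq, e1, e2,
    Left.neg_pos_iff]
  rw [mul_neg_iff] at h1 h2
  tauto

/-! ### Lists as graphs, reversals as flips. -/

/-- The graph whose edges join the consecutive points of a list. -/
def listGraph {V : Type*} (l : List V) : SimpleGraph V := SimpleGraph.fromRel (Nx l)

theorem listGraph_adj {V : Type*} {l : List V} (hl : l.Nodup) {a b : V} :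
    (listGraph l).Adj a b ↔ CCSystem.Adj l a b := by
  rw [listGraph, SimpleGraph.fromRel_adj]
  exact ⟨fun h => h.2, fun h => ⟨h.ne hl, h⟩⟩

theorem mem_edges_iff {V : Type*} {G : SimpleGraph V} {u v : V} (w : G.Walk u v) (a b : V) :
    s(a, b) ∈ w.edges ↔ CCSystem.Adj w.support a b := by
  induction w with
  | nil => simp
  | cons h p ih =>
    rw [SimpleGraph.Walk.edges_cons, SimpleGraph.Walk.support_cons, List.mem_cons, ih,
      ← SimpleGraph.Walk.cons_tail_support p, adj_cons_cons, Sym2.eq_iff]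
    tauto

theorem isSpanningPathBetween_listGraph {V : Type*} {s : V} {m : List V} (hn : (s :: m).Nodup)
    (hc : ∀ x, x ∈ s :: m) : ∃ t, IsSpanningPathBetween (listGraph (s :: m)) s t := by
  have hchain : (s :: m).IsChain (listGraph (s :: m)).Adj := by
    rw [List.isChain_iff_forall_rel_of_append_cons_cons]
    intro a b A B h
    rw [listGraph_adj hn]
    exact .inl ((nx_iff _ _ _).2 ⟨A, B, h⟩)
  obtain ⟨t, w, hsup⟩ : ∃ t, ∃ w : (listGraph (s :: m)).Walk s t, w.support = s :: m :=
    ⟨_, _, SimpleGraph.Walk.support_ofSupport (List.cons_ne_nil s m) hchain⟩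
  refine ⟨t, w, ?_, ?_, ?_⟩
  · rw [SimpleGraph.Walk.isPath_def, hsup]; exact hn
  · rw [hsup]; exact hc
  · intro e he
    induction e with
    | _ a b => rw [mem_edges_iff, hsup, ← listGraph_adj hn]; exact he

theorem eq_of_mem_segments {a b d : S} (h1 : a ≠ b) (h2 : a ≠ d) (h3 : b ≠ d)
    (hS : GeneralPosition S) {q : Plane} (hp : q ∈ segment ℝ (a : Plane) b)
    (hp' : q ∈ segment ℝ (a : Plane) d) : q = a := by
  rw [segment_eq_image_lineMap] at hp hp'
  obtain ⟨t, ht, rfl⟩ := hp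
  obtain ⟨u, hu, h⟩ := hp'
  have e1 := det_line (a : Plane) b a b t
  have e2 := det_line (a : Plane) b a d u
  rw [h, e1] at e2
  have e3 : det (a : Plane) b a = 0 := by unfold det; ring
  have e4 : det (a : Plane) b b = 0 := by unfold det; ring
  rw [e3, e4] at e2
  have e5 : u = 0 := by
    have := det_ne_zero hS h1 h3 h2
    simpa [this] using e2
  rw [← h, e5]
  simp

theorem isPlane_listGraph {l : List S} (hn : l.Nodup) (h : (orientation S hS).Plane l) :
    IsPlane (listGraph l) := by
  intro a b c d hab hcd hne p hp
  rw [listGraph_adj hn] at hab hcd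
  have n1 := hab.ne hn
  have n2 := hcd.ne hn
  have hne' : ¬ ((a = c ∧ b = d) ∨ (a = d ∧ b = c)) := by rwa [← Sym2.eq_iff]
  by_cases hnd : [a, b, c, d].Nodup
  · exact (h _ _ _ _ hab hcd (cr_of_segments_meet hnd ⟨p, hp⟩)).elim
  obtain ⟨hp1, hp2⟩ := hp
  have key : p = a ∧ (a = c ∨ a = d) ∨ p = b ∧ (b = c ∨ b = d) := by
    by_cases hac : a = c
    · subst hac
      exact .inl ⟨eq_of_mem_segments n1 n2 (by grind) hS hp1 hp2, .inl rfl⟩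
    by_cases had : a = d
    · subst had
      rw [segment_symm] at hp2
      exact .inl ⟨eq_of_mem_segments n1 n2.symm (by grind) hS hp1 hp2, .inr rfl⟩
    rw [segment_symm] at hp1
    by_cases hbc : b = c
    · subst hbc
      exact .inr ⟨eq_of_mem_segments n1.symm n2 (by grind) hS hp1 hp2, .inl rfl⟩
    have hbd : b = d := by grind
    subst hbd
    rw [segment_symm ℝ (c : Plane)] at hp2
    exact .inr ⟨eq_of_mem_segments n1.symm n2.symm (by grind) hS hp1 hp2, .inr rfl⟩
  rcases key with ⟨rfl, rfl | rfl⟩ | ⟨rfl, rfl | rfl⟩ <;> simp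

theorem plane_of_isPlane {l : List S} {P : SimpleGraph S}
    (hP : ∀ a b, P.Adj a b ↔ CCSystem.Adj l a b) (h : IsPlane P) :
    (orientation S hS).Plane l := by
  intro a b c d hab hcd hc
  have n := hc.nodup
  simp only [List.nodup_cons, List.mem_cons, List.not_mem_nil, not_or, or_false] at n
  obtain ⟨p, hp⟩ := segments_meet_of_cr hc
  have := h a b c d ((hP _ _).2 hab) ((hP _ _).2 hcd) (by rw [Ne, Sym2.eq_iff]; tauto) hp
  simp only [Set.mem_inter_iff, Set.mem_insert_iff, Set.mem_singleton_iff] at this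
  have hinj : ∀ {x y : S}, (x : Plane) = y → x = y := fun h => Subtype.ext h
  rcases this with ⟨h1 | h1, h2 | h2⟩ <;> have := hinj (h1.symm.trans h2) <;> tauto

theorem listGraph_mem {s : S} {m : List S}
    (h : (orientation S hS).Path Finset.univ (s :: m)) :
    listGraph (s :: m) ∈ planeSpanningPathsFrom S s := by
  obtain ⟨t, ht⟩ := isSpanningPathBetween_listGraph h.1 fun x => (h.2.1 x).2 (Finset.mem_univ x)
  exact ⟨⟨⟨s, t, ht⟩, isPlane_listGraph h.1 h.2.2⟩, t, ht⟩

theorem exists_list_of_mem {s : S} {P : SimpleGraph S} (h : P ∈ planeSpanningPathsFrom S s) :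
    ∃ m, (orientation S hS).Path Finset.univ (s :: m) ∧ listGraph (s :: m) = P := by
  obtain ⟨⟨-, hpl⟩, t, w, hw, hsup, hed⟩ := h
  have e := (SimpleGraph.Walk.cons_tail_support w).symm
  have hn : (s :: w.support.tail).Nodup := by rw [← e]; exact hw.support_nodup
  have hadj : ∀ a b, P.Adj a b ↔ CCSystem.Adj (s :: w.support.tail) a b := by
    intro a b
    rw [← e, ← mem_edges_iff]
    exact ⟨fun h => hed _ h, fun h => w.adj_of_mem_edges h⟩
  refine ⟨w.support.tail, ⟨hn, fun x => ?_, plane_of_isPlane hadj hpl⟩, ?_⟩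
  · rw [← e]; simp [hsup]
  · ext a b
    rw [listGraph_adj hn, hadj]

/-- Only the edge from `v` to the first point of `B` changes, to the edge from `v` to the last one.
If `B` has at most one point nothing changes, which is not a flip. -/
theorem isFlip_of_reverse {V : Type*} {A B : List V} {v : V} (hn : (A ++ v :: B).Nodup) :
    listGraph (A ++ v :: B) = listGraph (A ++ v :: B.reverse) ∨
      IsFlip (listGraph (A ++ v :: B)) (listGraph (A ++ v :: B.reverse)) := by
  rcases B with _ | ⟨x, B⟩
  · exact .inl rfl
  rcases B.eq_nil_or_concat with rfl | ⟨B, t, rfl⟩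
  · exact .inl rfl
  right
  rw [List.concat_eq_append] at *
  have hn' : (A ++ v :: (x :: (B ++ [t])).reverse).Nodup :=
    (((List.reverse_perm _).cons v).append_left A).nodup_iff.2 hn
  have e : (x :: (B ++ [t])).reverse = t :: (x :: B).reverse := by simp
  have hd := hn
  simp only [List.nodup_append, List.nodup_cons, List.mem_cons, List.mem_append] at hd
  refine ⟨s(v, x), ?_, s(v, t), ?_, ?_⟩
  · rw [SimpleGraph.mem_edgeSet, listGraph_adj hn, adj_append_append]; tauto
  · rw [SimpleGraph.mem_edgeSet, listGraph_adj hn, adj_mid hn]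
    rintro (⟨A', rfl⟩ | ⟨B', h⟩)
    · grind
    · have := (List.cons.inj h).1
      grind
  · ext f
    induction f with
    | _ a b =>
    rw [Set.mem_insert_iff, Set.mem_sdiff, SimpleGraph.mem_edgeSet, SimpleGraph.mem_edgeSet,
      listGraph_adj hn, listGraph_adj hn', Set.mem_singleton_iff, Sym2.eq_iff, Sym2.eq_iff,
      adj_append_append A v x, e, adj_append_append A v t, ← e, adj_reverse]
    have h1 : CCSystem.Adj (A ++ [v]) a b → a ≠ x ∧ b ≠ x := fun h => by
      have := h.mem
      simp only [List.mem_append, List.mem_singleton] at this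
      grind
    have h2 : CCSystem.Adj (x :: (B ++ [t])) a b → a ≠ v ∧ b ≠ v := fun h => by
      have := h.mem
      simp only [List.mem_cons, List.mem_append, List.not_mem_nil] at this
      grind
    have h3 : v ≠ x := by tauto
    grind

theorem reachable_of_reach {s : S} {m : List S} {l : List S}
    (h : (orientation S hS).Path Finset.univ (s :: m))
    (hr : (orientation S hS).Reach (s :: m) l) :
    ∃ h' : listGraph l ∈ planeSpanningPathsFrom S s,
      (flipGraph (planeSpanningPathsFrom S s)).Reachable ⟨_, listGraph_mem h⟩ ⟨_, h'⟩ := by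
  induction hr with
  | refl => exact ⟨listGraph_mem h, .rfl⟩
  | @tail l l' hl hstep ih =>
    obtain ⟨h1, h2⟩ := ih
    have hl' : (orientation S hS).Reach (s :: m) l' := hl.tail hstep
    obtain ⟨m', rfl⟩ := hl'.cons
    refine ⟨listGraph_mem (h.of_reach hl'), h2.trans ?_⟩
    have hn := (h.of_reach hl).1
    obtain ⟨-, -, A, v, B, rfl, e⟩ := hstep
    have key := isFlip_of_reverse hn
    rw [← e] at key
    rcases key with h' | h'
    · have : (⟨_, h1⟩ : planeSpanningPathsFrom S s) = ⟨_, listGraph_mem (h.of_reach hl')⟩ :=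
        Subtype.ext h'
      rw [this]
    · exact SimpleGraph.Adj.reachable h'

end PlanePath

theorem mainTheorem3 (S : Finset PlanePath.Plane) (hS : PlanePath.GeneralPosition S)
    (hL : PlanePath.layerNumber (S : Set PlanePath.Plane) ≤ 2)
    (s : S) (hs : (s : PlanePath.Plane) ∈ PlanePath.layer (S : Set PlanePath.Plane) 0) :
    (PlanePath.flipGraph (PlanePath.planeSpanningPathsFrom S s)).Connected := by
  have hs' := PlanePath.not_inner_of_layer (hS := hS) hs
  have h2 := PlanePath.twoLayers_of_layerNumber (hS := hS) hL
  obtain ⟨m₀, hm₀⟩ := CCSystem.exists_path (Finset.mem_univ s) hs'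
  have : Nonempty (PlanePath.planeSpanningPathsFrom S s) := ⟨⟨_, PlanePath.listGraph_mem hm₀⟩⟩
  refine SimpleGraph.Connected.mk fun P Q => ?_
  obtain ⟨P, hP⟩ := P
  obtain ⟨Q, hQ⟩ := Q
  obtain ⟨m, hm, rfl⟩ := PlanePath.exists_list_of_mem (hS := hS) hP
  obtain ⟨m', hm', rfl⟩ := PlanePath.exists_list_of_mem (hS := hS) hQ
  obtain ⟨_, h⟩ := PlanePath.reachable_of_reach hm
    (CCSystem.connected_of_twoLayers h2 (Finset.mem_univ s) hs' m m' hm hm')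
  exact h
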